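/- **Setting.** Let $(\mathbf X_t)_{t\in\mathbb Z}$, $\mathbf X_t=(X^1_t,\dots,X^m_t)$, be generated by a time series structural causal model $X^j_t:=f^j(\mathrm{pa}(X^j_t),\eta^j_t)$, where for each $t$ the noises $\eta^1_t,\dots,\eta^m_t$ are jointly independent and for each $j$ the noises $(\eta^j_t)_{t\in\mathbb Z}$ are i.i.d., and whose graph $\mathcal G_{ts}$ (nodes $X^i_t$, an edge $X^i_s\to X^j_t$ iff $X^i_s\in\mathrm{pa}(X^j_t)$) is a ts-DAG: it has no directed cycle and no edge pointing backwards in time. A ts-DAG $\mathcal G$ satisfies the *time series local Markov property* if every $X^i_t$ is independent, given its parents in $\mathcal G$, of every finite set of variables containing no descendant of $X^i_t$ in $\mathcal G$ (a node counts as its own descendant). It is *subgraph minimal* if it satisfies this property and no graph obtained from it by deleting at least one edge does. Assume: 1. $\mathcal G_{ts}$ satisfies the time series local Markov property; 2. faithfulness: for finite disjoint sets of variables, $\mathbf S_1\perp\!\!\!\perp \mathbf S_2\mid \mathbf S_3$ implies that $\mathbf S_1,\mathbf S_2$ are d-separated by $\mathbf S_3$ in $\mathcal G_{ts}$; 3.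 every edge of $\mathcal G_{ts}$ has time lag at most a known $\tau_{\max}\ge 0$; 4. the mechanisms $f^j$ do not change with time, and hence $\mathcal G_{ts}$ is invariant under time shifts; 5. $D_0,D_1,\dots$ are i.i.d. observations of the window $\{X^i_{t-\ell}: 1\le i\le m,\ 0\le \ell\le\tau_{\max}\}$ for some $t$, and $\mathcal B$ is a decomposable (e.g. Bayesian) scoring criterion for DAGs $\mathcal G$ over the window variables, $\mathcal B(\mathcal G,\mathbf D)=\sum_v b(v,\mathrm{pa}_{\mathcal G}(v),\mathbf D)$, that is locally consistent: if the DAG $\mathcal G'$ arises from the DAG $\mathcal G$ by adding an edge $a\to b$, then with probability tending to one as the sample size $n\to\infty$, $\mathcal B(\mathcal G',\mathbf D)>\mathcal B(\mathcal G,\mathbf D)$ if $b\not\perp\!\!\!\perp a\mid \mathrm{pa}_{\mathcal G}(b)$, and $\mathcal B(\mathcal G',\mathbf D)<\mathcal B(\mathcal G,\mathbf D)$ if $b\perp\!\!\!\perp a\mid \mathrm{pa}_{\mathcal G}(b)$. **Phase 1 of TS-BOSS** on the data $\mathbf D=(D_0,\dots,D_{n-1})$. A permutation $\pi$ of the window variables,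 with all lagged variables first, assigns to each contemporaneous variable $v=X^i_t$ a parent set by *grow–shrink*: starting with $S=\emptyset$, as long as adding some variable preceding $v$ in $\pi$ strictly improves the local score $b(v,S,\mathbf D)$, add one whose addition gives the largest score; then, as long as deleting some element of $S$ strictly improves the score, delete such an element. Ties in the grow phase and the choice among improving deletions are settled by an arbitrary rule. The score of $\pi$ is the sum over $i$ of the resulting local scores of $X^i_t$. Start with $\pi=(\mathbf X_{t-\tau_{\max}},\dots,\mathbf X_{t-1},\mathbf X_t)$. Repeatedly go through $i=1,\dots,m$, determine the permutation $\pi'$ obtained by moving $X^i_t$ to its best position among the contemporaneous positions, and, at the first $i$ for which the score of $\pi'$ exceeds that of $\pi$, replace $\pi$ by $\pi'$ and start again; stop when there is no such $i$. The output $\widehat{\mathcal G}_{ts}$ is the graph in which the parents of each $X^i_t$ are the grow–shrink parents for the final $\pi$, and these edges are repeated at all times. **Claim.** $\widehat{\mathcal G}_{ts}$ is always a time-shift invariant ts-DAG with time lags at most $\tau_{\max}$, and with probability tending to one as $n\to\infty$, $\widehat{\mathcal G}_{ts}$ satisfies the time series local Markov property with respect to $(\mathbf X_t)_{t\in\mathbb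 Z}$ and is subgraph minimal. -/

import Mathlib

open MeasureTheory ProbabilityTheory Filter Topology

/-! ## Time series graphs and d-separation -/

/-- Nodes of a time series graph: `(i, t)` stands for the variable `X^i_t`. -/
abbrev Node (m : ℕ) := Fin m × ℤ

/-- A directed graph on the nodes of an `m`-variate time series; `G u v` means `u → v`,
that is, `u` is a parent of `v`. -/
abbrev TsGraph (m : ℕ) := Node m → Node m → Prop

/-- The parents of `v`. -/
def parents {m : ℕ} (G : TsGraph m) (v : Node m) : Set (Node m) := {u | G u v}

/-- `w` is a descendant of `v` (every node is a descendant of itself). -/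
def IsDescendant {m : ℕ} (G : TsGraph m) (v w : Node m) : Prop := Relation.ReflTransGen G v w

/-- A ts-DAG: edges never point backwards in time and there are no directed cycles. -/
structure IsTsDAG {m : ℕ} (G : TsGraph m) : Prop where
  time_order : ∀ u v, G u v → u.2 ≤ v.2
  acyclic : ∀ v, ¬ Relation.TransGen G v v

/-- Every edge has time lag at most `τ`. -/
def HasMaxLag {m : ℕ} (G : TsGraph m) (τ : ℕ) : Prop := ∀ u v, G u v → v.2 - u.2 ≤ (τ : ℤ)

/-- The repeating edge property: the graph is invariant under time shifts. -/
def RepeatingEdges {m : ℕ} (G : TsGraph m) : Prop :=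
  ∀ (i j : Fin m) (s t r : ℤ), G (i, s) (j, t) ↔ G (i, s + r) (j, t + r)

/-- `p 0, …, p k` is a trail of `G` that is active given `Z`: consecutive nodes are adjacent, the
end points are not in `Z`, every inner collider has a descendant (possibly itself) in `Z`, and
every other inner node is not in `Z`. -/
def ActiveTrail {m : ℕ} (G : TsGraph m) (Z : Set (Node m)) (k : ℕ) (p : ℕ → Node m) : Prop :=
  (∀ r < k, G (p r) (p (r + 1)) ∨ G (p (r + 1)) (p r)) ∧
  p 0 ∉ Z ∧ p k ∉ Z ∧
  ∀ r, r + 1 < k →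
    ((G (p r) (p (r + 1)) ∧ G (p (r + 2)) (p (r + 1))) →
      ∃ z ∈ Z, IsDescendant G (p (r + 1)) z) ∧
    (¬ (G (p r) (p (r + 1)) ∧ G (p (r + 2)) (p (r + 1))) → p (r + 1) ∉ Z)

/-- `A` and `B` are d-separated given `Z`: no trail from `A` to `B` is active given `Z`. -/
def DSep {m : ℕ} (G : TsGraph m) (A B Z : Set (Node m)) : Prop :=
  ¬ ∃ (k : ℕ) (p : ℕ → Node m), p 0 ∈ A ∧ p k ∈ B ∧ ActiveTrail G Z k p

/-! ## Time series, conditional independence, Markov property, faithfulness -/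

section TimeSeries

variable {m : ℕ} {Ω : Type*} {E : Fin m → Type*} [∀ i, MeasurableSpace (E i)]

/-- The σ-algebra generated by the variables `X^i_t`, `(i, t) ∈ S`. -/
def sigmaOf (X : (v : Node m) → Ω → E v.1) (S : Set (Node m)) : MeasurableSpace Ω :=
  ⨆ v ∈ S, MeasurableSpace.comap (X v) inferInstance

lemma sigmaOf_le [mΩ : MeasurableSpace Ω] {X : (v : Node m) → Ω → E v.1}
    (hX : ∀ v, Measurable (X v)) (S : Set (Node m)) : sigmaOf X S ≤ mΩ :=
  iSup₂_le fun v _ => (hX v).comap_le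

variable [MeasurableSpace Ω] [StandardBorelSpace Ω]

/-- The variables indexed by `A` are conditionally independent of those indexed by `B`, given those
indexed by `C`. -/
def CI (μ : Measure Ω) [IsFiniteMeasure μ] {X : (v : Node m) → Ω → E v.1}
    (hX : ∀ v, Measurable (X v)) (A B C : Set (Node m)) : Prop :=
  CondIndep (sigmaOf X C) (sigmaOf X A) (sigmaOf X B) (sigmaOf_le hX C) μ

/-- The time series local Markov property of `G`: every variable is independent, given its parents,
of every finite set of variables that contains none of its descendants. -/
def LocalMarkov (μ : Measure Ω) [IsFiniteMeasure μ] {X : (v : Node m) → Ω → E v.1}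
    (hX : ∀ v, Measurable (X v)) (G : TsGraph m) : Prop :=
  ∀ (v : Node m) (I : Finset (Node m)), (∀ w ∈ I, ¬ IsDescendant G v w) →
    CI μ hX {v} I (parents G v)

/-- The time series faithfulness property of `G`. -/
def Faithful (μ : Measure Ω) [IsFiniteMeasure μ] {X : (v : Node m) → Ω → E v.1}
    (hX : ∀ v, Measurable (X v)) (G : TsGraph m) : Prop :=
  ∀ I₁ I₂ I₃ : Finset (Node m), Disjoint I₁ I₂ → Disjoint I₁ I₃ → Disjoint I₂ I₃ →
    CI μ hX I₁ I₂ I₃ → DSep G I₁ I₂ I₃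

/-- Subgraph minimality with respect to the time series local Markov property: `G` has the
property, and no graph obtained from `G` by deleting at least one edge has it. -/
def SubgraphMinimal (μ : Measure Ω) [IsFiniteMeasure μ] {X : (v : Node m) → Ω → E v.1}
    (hX : ∀ v, Measurable (X v)) (G : TsGraph m) : Prop :=
  LocalMarkov μ hX G ∧
    ∀ H : TsGraph m, (∀ u v, H u v → G u v) → H ≠ G → ¬ LocalMarkov μ hX H

end TimeSeries

/-! ## Structural causal models -/

/-- The time series `X` is generated by a time series structural causal model with ts-DAG `G`,
mechanisms `f` and noises `η`:  `X^j_t := f^j_t (pa(X^j_t), η^j_t)`. A mechanism is written as a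
function of the array `x` of all lagged values (`x i ℓ` being the value of `X^i_{t-ℓ}`), of which
it uses only the entries belonging to parents. -/
structure IsTsSCM {m : ℕ} {Ω : Type*} [MeasurableSpace Ω] {E : Fin m → Type*}
    [∀ i, MeasurableSpace (E i)] (μ : Measure Ω) (X : (v : Node m) → Ω → E v.1)
    {N : Fin m → Type*} [∀ j, MeasurableSpace (N j)]
    (η : (j : Fin m) → ℤ → Ω → N j)
    (f : (j : Fin m) → ℤ → ((i : Fin m) → ℕ → E i) → N j → E j)
    (G : TsGraph m) : Prop where
  dag : IsTsDAG G
  measurable_mechanism : ∀ j t,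
    Measurable fun p : ((i : Fin m) → ℕ → E i) × N j => f j t p.1 p.2
  measurable_noise : ∀ j t, Measurable (η j t)
  depends_on_parents : ∀ j t (x y : (i : Fin m) → ℕ → E i) (e : N j),
    (∀ (i : Fin m) (ℓ : ℕ), G (i, t - ℓ) (j, t) → x i ℓ = y i ℓ) → f j t x e = f j t y e
  structural : ∀ j t, ∀ᵐ ω ∂μ,
    X (j, t) ω = f j t (fun i ℓ => X (i, t - ℓ) ω) (η j t ω)
  noise_indep_components : ∀ t, iIndepFun (fun j => η j t) μ
  noise_indep_times : ∀ j, iIndepFun (fun t => η j t) μ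
  noise_ident : ∀ j s t, IdentDistrib (η j s) (η j t) μ μ

/-- Stationary causal structure: the parent sets (as sets of lagged variables) and the causal
mechanisms do not change with time. -/
structure StationaryMechanisms {m : ℕ} {E N : Fin m → Type*}
    (f : (j : Fin m) → ℤ → ((i : Fin m) → ℕ → E i) → N j → E j) (G : TsGraph m) : Prop where
  repeating : RepeatingEdges G
  mechanism : ∀ j s t, f j s = f j t

/-! ## Window graphs and scores -/

/-- Nodes of the window: `(i, ℓ)` stands for `X^i_{t-ℓ}`, `0 ≤ ℓ ≤ τ`, where `t` is the last time
of the window. -/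
abbrev WNode (m τ : ℕ) := Fin m × Fin (τ + 1)

/-- The node of the time series graph that a node of the window ending at time `t` stands for. -/
def place {m τ : ℕ} (t : ℤ) (w : WNode m τ) : Node m := (w.1, t - ((w.2 : ℕ) : ℤ))

/-- One observation of all variables of the window. -/
abbrev Sample {m : ℕ} (E : Fin m → Type*) (τ : ℕ) := (w : WNode m τ) → E w.1

/-- A directed acyclic graph over the window nodes, given by its parent sets. -/
structure WDAG (m τ : ℕ) where
  pa : WNode m τ → Finset (WNode m τ)
  acyclic : ∀ v, ¬ Relation.TransGen (fun a b => a ∈ pa b) v v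

/-- `loc v S` is the local score of `v` with parent set `S` (for given data). -/
abbrev LocalScore (m τ : ℕ) := WNode m τ → Finset (WNode m τ) → ℝ

/-- The decomposable score of a DAG: the sum of its local scores. -/
def WDAG.score {m τ : ℕ} (G : WDAG m τ) (loc : LocalScore m τ) : ℝ := ∑ v, loc v (G.pa v)

/-- A scoring criterion is locally consistent for the sample `D 0, D 1, …` from the window ending
at time `t` if, with `G'` the result of adding an edge `a → b` to a DAG `G`, with probability
tending to one as the sample size grows, the score of `G'` is larger than that of `G` if `b` depends
on `a` given the parents of `b` in `G`, and smaller if `b` and `a` are conditionally independent.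
(The probabilities of the complementary events are required to tend to zero.) -/
def LocallyConsistent {m τ : ℕ} {Ω Ω' : Type*} {E : Fin m → Type*} [∀ i, MeasurableSpace (E i)]
    [MeasurableSpace Ω] [StandardBorelSpace Ω] (μ : Measure Ω) [IsFiniteMeasure μ]
    {X : (v : Node m) → Ω → E v.1} (hX : ∀ v, Measurable (X v)) (t : ℤ)
    [MeasurableSpace Ω'] (P : Measure Ω') (D : ℕ → Ω' → Sample E τ)
    (B : (n : ℕ) → (Fin n → Sample E τ) → LocalScore m τ) : Prop :=
  ∀ (G G' : WDAG m τ) (a b : WNode m τ), a ∉ G.pa b →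
    G'.pa = Function.update G.pa b (insert a (G.pa b)) →
    (¬ CI μ hX {place t b} {place t a} (place t '' (G.pa b : Set (WNode m τ))) →
      Tendsto (fun n => P {ω | ¬ G.score (B n fun k => D k ω) < G'.score (B n fun k => D k ω)})
        atTop (𝓝 0)) ∧
    (CI μ hX {place t b} {place t a} (place t '' (G.pa b : Set (WNode m τ))) →
      Tendsto (fun n => P {ω | ¬ G'.score (B n fun k => D k ω) < G.score (B n fun k => D k ω)})
        atTop (𝓝 0))

/-! ## Grow–shrink trees -/

/-- A rule that selects, for a target and a current parent set, one element of every nonempty set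
of admissible choices. -/
structure SelectionRule (α : Type*) where
  pick : α → Finset α → Finset α → α
  pick_mem : ∀ v S C, C.Nonempty → pick v S C ∈ C

noncomputable section GrowShrink

variable {m τ : ℕ}

/-- The variables of the prefix `P` whose addition to the parent set `S` of `v` strictly improves
the score of `v`. -/
def improvingAdditions (loc : LocalScore m τ) (v : WNode m τ) (P S : Finset (WNode m τ)) :
    Finset (WNode m τ) :=
  (P \ S).filter fun a => loc v S < loc v (insert a S)

/-- The best ranked ones among the improving additions. -/
def bestAdditions (loc : LocalScore m τ) (v : WNode m τ) (P S : Finset (WNode m τ)) :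
    Finset (WNode m τ) :=
  (improvingAdditions loc v P S).filter fun a =>
    ∀ b ∈ improvingAdditions loc v P S, loc v (insert b S) ≤ loc v (insert a S)

/-- The parents of `v` whose deletion strictly improves the score of `v`. -/
def improvingDeletions (loc : LocalScore m τ) (v : WNode m τ) (S : Finset (WNode m τ)) :
    Finset (WNode m τ) :=
  S.filter fun a => loc v S < loc v (S.erase a)

lemma pick_bestAdditions_mem (loc : LocalScore m τ) (R : SelectionRule (WNode m τ))
    (v : WNode m τ) (P S : Finset (WNode m τ)) (h : (bestAdditions loc v P S).Nonempty) :
    R.pick v S (bestAdditions loc v P S) ∈ P \ S :=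
  (Finset.mem_filter.1 (Finset.mem_filter.1 (R.pick_mem v S _ h)).1).1

/-- The grow phase for target `v` and prefix `P`, started at the parent set `S`: a best ranked
improving variable is added as long as there is one; `R` breaks ties. -/
def grow (loc : LocalScore m τ) (R : SelectionRule (WNode m τ)) (v : WNode m τ)
    (P S : Finset (WNode m τ)) : Finset (WNode m τ) :=
  if h : (bestAdditions loc v P S).Nonempty then
    grow loc R v P (insert (R.pick v S (bestAdditions loc v P S)) S)
  else S
termination_by (P \ S).card
decreasing_by
  have hm := pick_bestAdditions_mem loc R v P S h
  apply Finset.card_lt_card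
  rw [Finset.ssubset_iff_of_subset
    (Finset.sdiff_subset_sdiff (Finset.Subset.refl P) (Finset.subset_insert _ _))]
  exact ⟨_, hm, fun h' => (Finset.mem_sdiff.1 h').2 (Finset.mem_insert_self _ _)⟩

/-- The shrink phase for target `v`, started at the parent set `S`: a parent whose deletion improves
the score is deleted as long as there is one; `R` selects it. -/
def shrink (loc : LocalScore m τ) (R : SelectionRule (WNode m τ)) (v : WNode m τ)
    (S : Finset (WNode m τ)) : Finset (WNode m τ) :=
  if h : (improvingDeletions loc v S).Nonempty then
    shrink loc R v (S.erase (R.pick v S (improvingDeletions loc v S)))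
  else S
termination_by S.card
decreasing_by
  exact Finset.card_erase_lt_of_mem (Finset.mem_filter.1 (R.pick_mem v S _ h)).1

/-- The parent set that the grow–shrink tree of `v` returns for the prefix `P`. -/
def gstParents (loc : LocalScore m τ) (Rg Rs : SelectionRule (WNode m τ)) (v : WNode m τ)
    (P : Finset (WNode m τ)) : Finset (WNode m τ) :=
  shrink loc Rs v (grow loc Rg v P ∅)

end GrowShrink

/-! ## Phase 1 of TS-BOSS -/

noncomputable section Phase1

variable {m τ : ℕ}

/-- The set of the variables that precede `v` in `π`. -/
def prefixOf (π : List (WNode m τ)) (v : WNode m τ) : Finset (WNode m τ) :=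
  (π.takeWhile fun w => w ≠ v).toFinset

/-- The parent set of the contemporaneous variable `X^i_t` induced by `π`. -/
def permParents (loc : LocalScore m τ) (Rg Rs : SelectionRule (WNode m τ))
    (π : List (WNode m τ)) (i : Fin m) : Finset (WNode m τ) :=
  gstParents loc Rg Rs (i, 0) (prefixOf π (i, 0))

/-- The score of a permutation: the sum over the grow–shrink trees, one for each contemporaneous
variable. -/
def permScore (loc : LocalScore m τ) (Rg Rs : SelectionRule (WNode m τ))
    (π : List (WNode m τ)) : ℝ :=
  ∑ i, loc (i, 0) (permParents loc Rg Rs π i)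

/-- The initial permutation `X_{t-τ}, …, X_{t-1}, X_t`. -/
def initPerm (m τ : ℕ) : List (WNode m τ) :=
  (List.finRange (τ + 1)).reverse.flatMap fun ℓ => (List.finRange m).map fun i => (i, ℓ)

/-- Move `v` to position `k` (counted from `0`). -/
def moveTo (π : List (WNode m τ)) (v : WNode m τ) (k : ℕ) : List (WNode m τ) :=
  (π.erase v).insertIdx k v

/-- One pass of the loop of `bestTSMove`; the state consists of the current permutation, the best
score so far, and the best position so far. -/
def bestTSMoveStep (score : List (WNode m τ) → ℝ) (v : WNode m τ)
    (st : List (WNode m τ) × ℝ × ℕ) (k : ℕ) : List (WNode m τ) × ℝ × ℕ :=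
  if st.2.1 < score (moveTo st.1 v (m * τ + k)) then
    (moveTo st.1 v (m * τ + k), score (moveTo st.1 v (m * τ + k)), m * τ + k)
  else (moveTo st.1 v (m * τ + k), st.2.1, st.2.2)

/-- Move the contemporaneous variable `X^i_t` to its best position in the contemporaneous block,
which occupies the positions `m τ, …, m τ + m - 1`. -/
def bestTSMove (score : List (WNode m τ) → ℝ) (π : List (WNode m τ)) (i : Fin m) :
    List (WNode m τ) :=
  let st := (List.range m).foldl (bestTSMoveStep score (i, 0)) (π, score π, π.idxOf (i, 0))
  moveTo st.1 (i, 0) st.2.2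

/-- The first contemporaneous variable whose best move strictly improves the score, if any. -/
def improvingVariable (score : List (WNode m τ) → ℝ) (π : List (WNode m τ)) : Option (Fin m) :=
  open Classical in
  (List.finRange m).find? fun i => decide (score π < score (bestTSMove score π i))

lemma improvingVariable_lt {score : List (WNode m τ) → ℝ} {π : List (WNode m τ)} {i : Fin m}
    (h : improvingVariable score π = some i) : score π < score (bestTSMove score π i) := by
  classical
  have := List.find?_some h
  simpa using this

/-- The permutation search: as long as the best move of some contemporaneous variable improves the
score, make the first such move. -/
def permSearch (loc : LocalScore m τ) (Rg Rs : SelectionRule (WNode m τ))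
    (π : List (WNode m τ)) : List (WNode m τ) :=
  match h : improvingVariable (permScore loc Rg Rs) π with
  | none => π
  | some i => permSearch loc Rg Rs (bestTSMove (permScore loc Rg Rs) π i)
termination_by (Finset.univ.filter fun g : Fin m → Finset (WNode m τ) =>
  permScore loc Rg Rs π < ∑ i, loc (i, 0) (g i)).card
decreasing_by
  have hlt := improvingVariable_lt h
  apply Finset.card_lt_card
  rw [Finset.ssubset_iff_of_subset]
  · refine ⟨permParents loc Rg Rs (bestTSMove (permScore loc Rg Rs) π i), ?_, ?_⟩
    · exact Finset.mem_filter.2 ⟨Finset.mem_univ _, hlt⟩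
    · intro h'
      exact lt_irrefl _ (Finset.mem_filter.1 h').2
  · intro g hg
    exact Finset.mem_filter.2 ⟨Finset.mem_univ _, hlt.trans (Finset.mem_filter.1 hg).2⟩

/-- The ts-DAG induced by a permutation: the parents of the contemporaneous variables are those
returned by the grow–shrink trees, and these edges are repeated at all times. -/
def project (loc : LocalScore m τ) (Rg Rs : SelectionRule (WNode m τ))
    (π : List (WNode m τ)) : TsGraph m :=
  fun u v => ∃ ℓ : Fin (τ + 1), u.2 = v.2 - ((ℓ : ℕ) : ℤ) ∧
    (u.1, ℓ) ∈ permParents loc Rg Rs π v.1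

/-- The ts-DAG returned by phase 1 of TS-BOSS. -/
def tsBossPhase1 (loc : LocalScore m τ) (Rg Rs : SelectionRule (WNode m τ)) : TsGraph m :=
  project loc Rg Rs (permSearch loc Rg Rs (initPerm m τ))

end Phase1

/-! ## Conditional independence of σ-algebras -/

section CondIndepSigma

variable {Ω : Type*}

/-! There are only finitely many comparisons between a parent set and the same set with one more
parent. By local consistency and a union bound, all of them agree with the conditional
independencies of the window at time `t` with probability tending to one
(`LocallyConsistent.tendsto_scoreReflectsCI`). The rest is deterministic: on this event every
permutation with the lagged variables first induces a Markov and subgraph minimal graph, and the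
search only visits such permutations (`IsAdmissible.permSearch`).

For a target `v` with predecessors `P`, grow–shrink returns a set `S` that separates `v` from each
single element of `P \ S` and contains no redundant element (`gstParents_markovBoundary`). Two gaps
remain: these independencies are pairwise, and they hold at time `t` only, while the law of the
series need not be shift invariant. Both are bridged by the graph (`IsFaithfulModel.ci_prefix`):
faithfulness gives d-separation at time `t`, shift invariance moves it to any time `s`, pairwise
d-separation is joint d-separation, and a global Markov property (`ci_of_dSep`) returns joint
independence at time `s`. That property is needed only for a `P` containing the `τ` preceding time
steps, so one moralises the finite set of contemporaneous ancestors and never factorises the past.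

Hence each variable is independent of its predecessors, in the order by time and then by
permutation, given its parents; `localMarkov_of_ordered` yields the local Markov property. If a
proper subgraph were Markov too, a parent deleted by it would be redundant at some time, hence at
time `t`, contradicting the end of the shrink phase. -/

lemma sup_eq_generateFrom_inter (m₁ m₂ : MeasurableSpace Ω) :
    m₁ ⊔ m₂ = MeasurableSpace.generateFrom
      {u | ∃ b c, MeasurableSet[m₁] b ∧ MeasurableSet[m₂] c ∧ u = b ∩ c} := by
  apply le_antisymm
  · refine sup_le (fun b hb => ?_) (fun c hc => ?_)
    · exact MeasurableSpace.measurableSet_generateFrom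
        ⟨b, Set.univ, hb, @MeasurableSet.univ _ m₂, by simp⟩
    · exact MeasurableSpace.measurableSet_generateFrom
        ⟨Set.univ, c, @MeasurableSet.univ _ m₁, hc, by simp⟩
  · refine MeasurableSpace.generateFrom_le ?_
    rintro u ⟨b, c, hb, hc, rfl⟩
    exact @MeasurableSet.inter _ (m₁ ⊔ m₂) _ _ ((le_sup_left : m₁ ≤ m₁ ⊔ m₂) b hb)
      ((le_sup_right : m₂ ≤ m₁ ⊔ m₂) c hc)

lemma isPiSystem_inter (m₁ m₂ : MeasurableSpace Ω) :
    IsPiSystem {u | ∃ b c, MeasurableSet[m₁] b ∧ MeasurableSet[m₂] c ∧ u = b ∩ c} := by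
  rintro _ ⟨b, c, hb, hc, rfl⟩ _ ⟨b', c', hb', hc', rfl⟩ -
  exact ⟨b ∩ b', c ∩ c', @MeasurableSet.inter _ m₁ _ _ hb hb', @MeasurableSet.inter _ m₂ _ _ hc hc',
    by ext; simp; tauto⟩

variable {m' m₁ m₂ m₃ : MeasurableSpace Ω} [mΩ : MeasurableSpace Ω] [StandardBorelSpace Ω]
  {μ : Measure Ω} [IsFiniteMeasure μ]

/-- The sets `b ∩ c` generate `m₂ ⊔ m'`. On them, conditioning on `m'` turns the integral of `P(a |
m') 1_b` into that of `P(a | m') P(b | m')`, which is `P(a ∩ b | m')` by conditional independence.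
-/
lemma condExp_indicator_mul_eq (hm' : m' ≤ mΩ)
    (h₁ : m₁ ≤ mΩ) (h₂ : m₂ ≤ mΩ) (h : CondIndep m' m₁ m₂ hm' μ) {a b c : Set Ω}
    (ha : MeasurableSet[m₁] a) (hb : MeasurableSet[m₂] b) (hc : MeasurableSet[m'] c) :
    ∫ ω in b ∩ c, (μ⟦a | m'⟧) ω ∂μ = ∫ ω in b ∩ c, a.indicator (fun _ => (1 : ℝ)) ω ∂μ := by
  have hbi : Integrable (b.indicator fun _ => (1 : ℝ)) μ :=
    (integrable_const 1).indicator (h₂ _ hb)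
  have hai : Integrable (a.indicator fun _ => (1 : ℝ)) μ :=
    (integrable_const 1).indicator (h₁ _ ha)
  have hci := (condIndep_iff m' m₁ m₂ hm' h₁ h₂ μ).1 h a b ha hb
  have hprod : Integrable ((μ⟦a | m'⟧) * (b.indicator fun _ => (1 : ℝ))) μ := by
    have : (μ⟦a | m'⟧) * (b.indicator fun _ => (1 : ℝ)) = b.indicator (μ⟦a | m'⟧) := by
      ext ω; by_cases hω : ω ∈ b <;> simp [hω]
    rw [this]
    exact integrable_condExp.indicator (h₂ _ hb)
  have hpull := condExp_mul_of_stronglyMeasurable_left (μ := μ)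
    (stronglyMeasurable_condExp (f := a.indicator fun _ => (1 : ℝ)) (m := m') (μ := μ)) hprod hbi
  calc ∫ ω in b ∩ c, (μ⟦a | m'⟧) ω ∂μ
      = ∫ ω in c, ((μ⟦a | m'⟧) * (b.indicator fun _ => (1 : ℝ))) ω ∂μ := by
        rw [Set.inter_comm, ← setIntegral_indicator (h₂ _ hb)]
        congr 1; ext ω; by_cases hω : ω ∈ b <;> simp [hω]
    _ = ∫ ω in c, (μ[(μ⟦a | m'⟧) * (b.indicator fun _ => (1 : ℝ)) | m']) ω ∂μ :=
        (setIntegral_condExp hm' hprod hc).symm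
    _ = ∫ ω in c, (μ⟦a ∩ b | m'⟧) ω ∂μ := by
        refine integral_congr_ae (ae_restrict_of_ae ?_)
        exact hpull.trans hci.symm
    _ = ∫ ω in c, (a ∩ b).indicator (fun _ => (1 : ℝ)) ω ∂μ :=
        setIntegral_condExp hm' ((integrable_const 1).indicator ((h₁ _ ha).inter (h₂ _ hb))) hc
    _ = ∫ ω in b ∩ c, a.indicator (fun _ => (1 : ℝ)) ω ∂μ := by
        rw [Set.inter_comm b c, ← setIntegral_indicator (h₂ _ hb), Set.indicator_indicator,
          Set.inter_comm b a]

/-- Two σ-algebras are conditionally independent if and only if adding one of them to the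
condition does not change the conditional probabilities of the events of the other. -/
lemma condIndep_iff_condExp_sup (hm' : m' ≤ mΩ)
    (h₁ : m₁ ≤ mΩ) (h₂ : m₂ ≤ mΩ) :
    CondIndep m' m₁ m₂ hm' μ ↔
      ∀ a, MeasurableSet[m₁] a → μ⟦a | m₂ ⊔ m'⟧ =ᵐ[μ] μ⟦a | m'⟧ := by
  have hsup : m₂ ⊔ m' ≤ mΩ := sup_le h₂ hm'
  constructor
  · intro h a ha
    have hai : Integrable (a.indicator fun _ => (1 : ℝ)) μ :=
      (integrable_const 1).indicator (h₁ _ ha)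
    have hmeas : StronglyMeasurable[m₂ ⊔ m'] (μ⟦a | m'⟧) :=
      stronglyMeasurable_condExp.mono (le_sup_right : m' ≤ m₂ ⊔ m')
    refine (ae_eq_condExp_of_forall_setIntegral_eq hsup hai
      (fun _ _ _ => integrable_condExp.integrableOn) (fun s hs _ => ?_)
      hmeas.aestronglyMeasurable).symm
    -- Dynkin's π-λ argument extends the identity from the sets `b ∩ c` to all of `m₂ ⊔ m'`.
    refine MeasurableSpace.induction_on_inter
      (C := fun s _ => ∫ x in s, (μ⟦a | m'⟧) x ∂μ = ∫ x in s, a.indicator (fun _ => (1 : ℝ)) x ∂μ)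
      (sup_eq_generateFrom_inter m₂ m') (isPiSystem_inter m₂ m') (by simp) ?_ ?_ ?_ s hs
    · rintro _ ⟨b, c, hb, hc, rfl⟩
      exact condExp_indicator_mul_eq hm' h₁ h₂ h ha hb hc
    · intro t ht hEq
      rw [setIntegral_compl (hsup _ ht) integrable_condExp, setIntegral_compl (hsup _ ht) hai, hEq,
        integral_condExp hm']
    · intro g hdisj hg hEq
      rw [integral_iUnion (fun i => hsup _ (hg i)) hdisj integrable_condExp.integrableOn,
        integral_iUnion (fun i => hsup _ (hg i)) hdisj hai.integrableOn]
      exact tsum_congr hEq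
  · intro h
    rw [condIndep_iff m' m₁ m₂ hm' h₁ h₂]
    intro a b ha hb
    have hai : Integrable (a.indicator fun _ => (1 : ℝ)) μ :=
      (integrable_const 1).indicator (h₁ _ ha)
    have hbi : Integrable (b.indicator fun _ => (1 : ℝ)) μ :=
      (integrable_const 1).indicator (h₂ _ hb)
    have hind : ∀ g : Ω → ℝ, (b.indicator fun _ => (1 : ℝ)) * g = b.indicator g := by
      intro g; ext ω; by_cases hω : ω ∈ b <;> simp [hω]
    have hab : (a ∩ b).indicator (fun _ => (1 : ℝ)) =
        (b.indicator fun _ => (1 : ℝ)) * (a.indicator fun _ => (1 : ℝ)) := by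
      rw [hind, Set.indicator_indicator, Set.inter_comm]
    have hbm : StronglyMeasurable[m₂ ⊔ m'] (b.indicator fun _ => (1 : ℝ)) :=
      stronglyMeasurable_const.indicator ((le_sup_left : m₂ ≤ m₂ ⊔ m') _ hb)
    have hpull₁ := condExp_mul_of_stronglyMeasurable_left (μ := μ) hbm
      (by rw [hind]; exact hai.indicator (h₂ _ hb)) hai
    have hint : Integrable ((b.indicator fun _ => (1 : ℝ)) * (μ⟦a | m'⟧)) μ := by
      rw [hind]; exact integrable_condExp.indicator (h₂ _ hb)
    have hpull₂ := condExp_mul_of_stronglyMeasurable_right (μ := μ)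
      (stronglyMeasurable_condExp (f := a.indicator fun _ => (1 : ℝ)) (m := m') (μ := μ)) hint hbi
    -- Tower property: inside `E[· | m']`, the factor `P(a | m₂ ⊔ m')` next to `1_b` may be replaced
    -- by `P(a | m')`, which then comes out.
    have htower := condExp_condExp_of_le (μ := μ) (f := (a ∩ b).indicator fun _ => (1 : ℝ))
      (le_sup_right : m' ≤ m₂ ⊔ m') hsup
    refine htower.symm.trans ?_
    rw [hab]
    refine (condExp_congr_ae (hpull₁.trans ?_)).trans (hpull₂.trans ?_)
    · filter_upwards [h a ha] with ω hω
      simp [hω]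
    · rw [mul_comm]

lemma condIndep_sup_right (hm' : m' ≤ mΩ)
    (h₁ : m₁ ≤ mΩ) (h₂ : m₂ ≤ mΩ) (h : CondIndep m' m₁ m₂ hm' μ) :
    CondIndep m' m₁ (m₂ ⊔ m') hm' μ := by
  rw [condIndep_iff_condExp_sup hm' h₁ h₂] at h
  rw [condIndep_iff_condExp_sup hm' h₁ (sup_le h₂ hm'), sup_assoc, sup_idem]
  exact h

/-- The conditional probabilities given `m₂ ⊔ m₃ ⊔ m'` and given `m₃ ⊔ m'` both equal those given
`m'`. Contraction chains the same equalities in the other direction. -/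
lemma condIndep_weak_union (hm' : m' ≤ mΩ)
    (h₁ : m₁ ≤ mΩ) (h₂ : m₂ ≤ mΩ) (h₃ : m₃ ≤ mΩ) (h : CondIndep m' m₁ (m₂ ⊔ m₃) hm' μ) :
    CondIndep (m₃ ⊔ m') m₁ m₂ (sup_le h₃ hm') μ := by
  have h' := condIndep_of_condIndep_of_le_right h (le_sup_right : m₃ ≤ m₂ ⊔ m₃)
  rw [condIndep_iff_condExp_sup hm' h₁ (sup_le h₂ h₃)] at h
  rw [condIndep_iff_condExp_sup hm' h₁ h₃] at h'
  rw [condIndep_iff_condExp_sup _ h₁ h₂, ← sup_assoc]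
  exact fun a ha => (h a ha).trans (h' a ha).symm

lemma condIndep_contraction (hm' : m' ≤ mΩ)
    (h₁ : m₁ ≤ mΩ) (h₂ : m₂ ≤ mΩ) (h₃ : m₃ ≤ mΩ) (h : CondIndep m' m₁ m₃ hm' μ)
    (h' : CondIndep (m₃ ⊔ m') m₁ m₂ (sup_le h₃ hm') μ) :
    CondIndep m' m₁ (m₂ ⊔ m₃) hm' μ := by
  rw [condIndep_iff_condExp_sup hm' h₁ h₃] at h
  rw [condIndep_iff_condExp_sup _ h₁ h₂, ← sup_assoc] at h'
  rw [condIndep_iff_condExp_sup hm' h₁ (sup_le h₂ h₃)]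
  exact fun a ha => (h' a ha).trans (h a ha)

lemma condIndep_congr_cond {m'' : MeasurableSpace Ω} {h' : m' ≤ mΩ} {h'' : m'' ≤ mΩ}
    (h : m' = m'') : CondIndep m' m₁ m₂ h' μ ↔ CondIndep m'' m₁ m₂ h'' μ := by
  subst h; rfl

end CondIndepSigma

/-! ## The semigraphoid axioms for the variables of a time series -/

section Semigraphoid

variable {m : ℕ} {Ω : Type*} {E : Fin m → Type*} [∀ i, MeasurableSpace (E i)]

lemma sigmaOf_mono (X : (v : Node m) → Ω → E v.1) {S T : Set (Node m)} (h : S ⊆ T) :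
    sigmaOf X S ≤ sigmaOf X T :=
  biSup_mono fun _ hv => h hv

lemma sigmaOf_union (X : (v : Node m) → Ω → E v.1) (S T : Set (Node m)) :
    sigmaOf X (S ∪ T) = sigmaOf X S ⊔ sigmaOf X T := by
  simp only [sigmaOf, iSup_union]

lemma sigmaOf_empty (X : (v : Node m) → Ω → E v.1) : sigmaOf X ∅ = ⊥ := by
  simp [sigmaOf]

variable [MeasurableSpace Ω] [StandardBorelSpace Ω] {μ : Measure Ω} [IsFiniteMeasure μ]
  {X : (v : Node m) → Ω → E v.1} {hX : ∀ v, Measurable (X v)} {A B C D : Set (Node m)}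

namespace CI

lemma symm (h : CI μ hX A B C) : CI μ hX B A C := CondIndep.symm h

lemma mono_right (h : CI μ hX A B C) (hD : D ⊆ B) : CI μ hX A D C :=
  condIndep_of_condIndep_of_le_right h (sigmaOf_mono X hD)

lemma mono_left (h : CI μ hX A B C) (hD : D ⊆ A) : CI μ hX D B C :=
  condIndep_of_condIndep_of_le_left h (sigmaOf_mono X hD)

lemma empty_left : CI μ hX ∅ B C := by
  unfold CI; rw [sigmaOf_empty]; exact condIndep_bot_left _

lemma union_cond (h : CI μ hX A B C) : CI μ hX A (B ∪ C) C := by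
  unfold CI
  rw [sigmaOf_union]
  exact condIndep_sup_right _ (sigmaOf_le hX _) (sigmaOf_le hX _) h

lemma weak_union (h : CI μ hX A (B ∪ D) C) : CI μ hX A B (D ∪ C) := by
  unfold CI at h ⊢
  rw [sigmaOf_union] at h
  exact (condIndep_congr_cond (sigmaOf_union X D C).symm).1
    (condIndep_weak_union _ (sigmaOf_le hX _) (sigmaOf_le hX _) (sigmaOf_le hX _) h)

lemma contraction (h : CI μ hX A D C) (h' : CI μ hX A B (D ∪ C)) : CI μ hX A (B ∪ D) C := by
  unfold CI at h h' ⊢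
  rw [sigmaOf_union]
  exact condIndep_contraction _ (sigmaOf_le hX _) (sigmaOf_le hX _) (sigmaOf_le hX _) h
    ((condIndep_congr_cond (sigmaOf_union X D C)).1 h')

/-- Weak union, with redundant variables allowed on the right. -/
lemma enlarge_cond (h : CI μ hX A D C) (hB : B ⊆ D) {C' : Set (Node m)} (hC : C ⊆ C')
    (hC' : C' ⊆ D ∪ C) : CI μ hX A B C' := by
  have h1 : CI μ hX A (B ∪ C') C := h.union_cond.mono_right
    (Set.union_subset (hB.trans Set.subset_union_left) hC')
  have h2 := h1.weak_union
  rwa [Set.union_eq_self_of_subset_right hC] at h2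

end CI

end Semigraphoid

/-! ## Extending active trails -/

section Trails

variable {m : ℕ} {G : TsGraph m} {Z : Set (Node m)}

lemma IsTsDAG.asymm (hG : IsTsDAG G) {u v : Node m} (h : G u v) : ¬ G v u := fun h' =>
  hG.acyclic u (.tail (.single h) h')

lemma IsTsDAG.time_le_of_isDescendant (hG : IsTsDAG G) {u v : Node m} (h : IsDescendant G u v) :
    u.2 ≤ v.2 := by
  induction h with
  | refl => exact le_rfl
  | tail _ h ih => exact ih.trans (hG.time_order _ _ h)

/-- The requirements of `ActiveTrail` except for the one on the last node. -/
def OpenTrail (G : TsGraph m) (Z : Set (Node m)) (k : ℕ) (p : ℕ → Node m) : Prop :=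
  (∀ r < k, G (p r) (p (r + 1)) ∨ G (p (r + 1)) (p r)) ∧
  p 0 ∉ Z ∧
  ∀ r, r + 1 < k →
    ((G (p r) (p (r + 1)) ∧ G (p (r + 2)) (p (r + 1))) →
      ∃ z ∈ Z, IsDescendant G (p (r + 1)) z) ∧
    (¬ (G (p r) (p (r + 1)) ∧ G (p (r + 2)) (p (r + 1))) → p (r + 1) ∉ Z)

lemma activeTrail_iff_openTrail {k : ℕ} {p : ℕ → Node m} :
    ActiveTrail G Z k p ↔ OpenTrail G Z k p ∧ p k ∉ Z := by
  unfold ActiveTrail OpenTrail; tauto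

/-- Trails may revisit nodes, so prolonging one creates a single new requirement, at the former end
point `p k`. For `k = 0` this point stays an end point and `hin` is vacuous. -/
lemma OpenTrail.extend {k : ℕ} {p : ℕ → Node m} (h : OpenTrail G Z k p) {x : Node m}
    (hadj : G (p k) x ∨ G x (p k))
    (hin : ∀ r, r + 1 = k → ((G (p r) (p k) ∧ G x (p k)) → ∃ z ∈ Z, IsDescendant G (p k) z) ∧
      (¬ (G (p r) (p k) ∧ G x (p k)) → p k ∉ Z)) :
    OpenTrail G Z (k + 1) (Function.update p (k + 1) x) := by
  have hlow : ∀ r, r ≤ k → Function.update p (k + 1) x r = p r := fun r hr =>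
    Function.update_of_ne (by omega) _ _
  have htop : Function.update p (k + 1) x (k + 1) = x := Function.update_self _ _ _
  refine ⟨fun r hr => ?_, ?_, fun r hr => ?_⟩
  · rcases Nat.lt_succ_iff_lt_or_eq.1 hr with h' | rfl
    · rw [hlow r h'.le, hlow (r + 1) h']; exact h.1 r h'
    · rw [hlow r le_rfl, htop]; exact hadj
  · rw [hlow 0 (Nat.zero_le _)]; exact h.2.1
  · rcases Nat.lt_succ_iff_lt_or_eq.1 hr with h' | h'
    · rw [hlow r (by omega), hlow (r + 1) h'.le, hlow (r + 2) h']; exact h.2.2 r h'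
    · subst h'
      rw [hlow r (by omega), hlow (r + 1) le_rfl, htop]; exact hin r rfl

/-- There is an active trail given `Z` from `v` to `w`. -/
def DConnected (G : TsGraph m) (Z : Set (Node m)) (v w : Node m) : Prop :=
  ∃ k p, p 0 = v ∧ p k = w ∧ ActiveTrail G Z k p

lemma DConnected.right_notMem {v w : Node m} (h : DConnected G Z v w) : w ∉ Z := by
  obtain ⟨k, p, -, rfl, h⟩ := h
  exact h.2.2.1

lemma DConnected.refl {v : Node m} (hv : v ∉ Z) : DConnected G Z v v :=
  ⟨0, fun _ => v, rfl, rfl, by simp, hv, hv, by simp⟩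

lemma DSep.not_dConnected {A B : Set (Node m)} (h : DSep G A B Z) {v w : Node m} (hv : v ∈ A)
    (hw : w ∈ B) : ¬ DConnected G Z v w := by
  rintro ⟨k, p, rfl, rfl, hp⟩
  exact h ⟨k, p, hv, hw, hp⟩

lemma dSep_iff {A B : Set (Node m)} :
    DSep G A B Z ↔ ∀ v ∈ A, ∀ w ∈ B, ¬ DConnected G Z v w := by
  refine ⟨fun h v hv w hw => h.not_dConnected hv hw, ?_⟩
  rintro h ⟨k, p, hv, hw, hp⟩
  exact h _ hv _ hw ⟨k, p, rfl, rfl, hp⟩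

lemma OpenTrail.dConnected_extend {k : ℕ} {p : ℕ → Node m} (h : OpenTrail G Z k p) {x : Node m}
    (hx : x ∉ Z) (hadj : G (p k) x ∨ G x (p k))
    (hin : ∀ r, r + 1 = k → ((G (p r) (p k) ∧ G x (p k)) → ∃ z ∈ Z, IsDescendant G (p k) z) ∧
      (¬ (G (p r) (p k) ∧ G x (p k)) → p k ∉ Z)) : DConnected G Z (p 0) x :=
  ⟨k + 1, Function.update p (k + 1) x, Function.update_of_ne (by omega) _ _,
    Function.update_self _ _ _, activeTrail_iff_openTrail.2
      ⟨h.extend hadj hin, by rwa [Function.update_self]⟩⟩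

/-- The edge to `y` leaves `x`, so `x` is not a collider. This and the following lemmas are the
moves by which d-connection to `v` spreads through a family, that is, along the edges of the moral
graph. -/
lemma DConnected.child (hG : IsTsDAG G) {v x y : Node m} (h : DConnected G Z v x) (hxy : G x y)
    (hy : y ∉ Z) : DConnected G Z v y := by
  obtain ⟨k, p, rfl, rfl, h⟩ := h
  rw [activeTrail_iff_openTrail] at h
  exact h.1.dConnected_extend hy (.inl hxy) fun r _ =>
    ⟨fun h' => absurd h'.2 (hG.asymm hxy), fun _ => h.2⟩

lemma DConnected.descendant (hG : IsTsDAG G) {v w y : Node m} (h : DConnected G Z v w)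
    (hw : ∀ z ∈ Z, ¬ IsDescendant G w z) (hy : IsDescendant G w y) : DConnected G Z v y := by
  induction hy with
  | refl => exact h
  | tail hx hxy ih => exact ih.child hG hxy fun hy => hw _ hy (hx.tail hxy)

/-- As an end point `w` lies outside `Z`, and it has a descendant in `Z`; so it is passable whether
or not it becomes a collider. -/
lemma DConnected.parent_of_ancestor {v w y : Node m}
    (h : DConnected G Z v w) (hyw : G y w) (hy : y ∉ Z) (hw : ∃ z ∈ Z, IsDescendant G w z) :
    DConnected G Z v y := by
  obtain ⟨k, p, rfl, rfl, h⟩ := h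
  rw [activeTrail_iff_openTrail] at h
  exact h.1.dConnected_extend hy (.inr hyw) fun r _ => ⟨fun _ => hw, fun _ => h.2⟩

lemma DConnected.spouse (hG : IsTsDAG G) {v x w y : Node m} (h : DConnected G Z v x) (hxw : G x w)
    (hyw : G y w) (hw : w ∈ Z) (hy : y ∉ Z) : DConnected G Z v y := by
  obtain ⟨k, p, rfl, rfl, h⟩ := h
  rw [activeTrail_iff_openTrail] at h
  have h1 := h.1.extend (x := w) (.inl hxw) fun r _ =>
    ⟨fun h' => absurd h'.2 (hG.asymm hxw), fun _ => h.2⟩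
  have h0 : Function.update p (k + 1) w 0 = p 0 := Function.update_of_ne (by omega) _ _
  rw [← h0]
  refine h1.dConnected_extend hy (.inr (by rwa [Function.update_self])) fun r hr => ?_
  obtain rfl : r = k := by omega
  have hr0 : Function.update p (r + 1) w r = p r := Function.update_of_ne (by omega) _ _
  rw [Function.update_self, hr0]
  exact ⟨fun _ => ⟨w, hw, .refl⟩, fun h' => absurd ⟨hxw, hyw⟩ h'⟩

/-- If no descendant of the ancestor `w` of `v` is in `Z`, then a directed path from `w` to `v` is
an active trail from `v` to `w`, and it can be continued to the parents of `w`. -/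
lemma exists_trail_to_ancestor (hG : IsTsDAG G) {v w : Node m} (h : IsDescendant G w v)
    (hw : ∀ z ∈ Z, ¬ IsDescendant G w z) :
    ∃ k p, p 0 = v ∧ p k = w ∧ OpenTrail G Z k p ∧ ∀ r, r + 1 = k → ¬ G (p r) (p k) := by
  -- The last conjunct keeps the final edge from pointing into `w`, so `w` is a non-collider
  -- whichever way the trail continues.
  induction h using Relation.ReflTransGen.head_induction_on with
  | refl =>
    exact ⟨0, fun _ => v, rfl, rfl, ⟨by simp, fun hv => hw v hv .refl, by simp⟩, by simp⟩
  | head hwx hx ih =>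
    rename_i w x
    obtain ⟨k, p, h0, rfl, hp, hlast⟩ := ih fun z hz hd => hw z hz (.head hwx hd)
    refine ⟨k + 1, Function.update p (k + 1) w, ?_, Function.update_self _ _ _,
      hp.extend (.inr hwx) fun r hr => ⟨fun h' => absurd h'.1 (hlast r hr), fun _ h' =>
        hw _ h' (.single hwx)⟩, ?_⟩
    · rwa [Function.update_of_ne (by omega)]
    · intro r hr
      obtain rfl : r = k := by omega
      rw [Function.update_self, Function.update_of_ne (by omega)]
      exact hG.asymm hwx

lemma dConnected_parent_of_isDescendant (hG : IsTsDAG G) {v w y : Node m}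
    (h : IsDescendant G w v) (hw : ∀ z ∈ Z, ¬ IsDescendant G w z) (hyw : G y w) (hy : y ∉ Z) :
    DConnected G Z v y := by
  obtain ⟨k, p, rfl, rfl, hp, hlast⟩ := exists_trail_to_ancestor hG h hw
  exact hp.dConnected_extend hy (.inr hyw) fun r hr =>
    ⟨fun h' => absurd h'.1 (hlast r hr), fun _ h' => hw _ h' .refl⟩

end Trails

/-! ## A global Markov property for the variables of one time step -/

section GlobalMarkov

variable {m : ℕ} {G : TsGraph m}

lemma exists_maximal_of_acyclic (hG : IsTsDAG G) {K : Finset (Node m)} (hK : K.Nonempty) :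
    ∃ w ∈ K, ∀ u ∈ K, ¬ Relation.TransGen G w u := by
  let r : K → K → Prop := fun a b => Relation.TransGen G b.1 a.1
  have : IsTrans K r := ⟨fun a b c hab hbc => hbc.trans hab⟩
  have : Std.Irrefl r := ⟨fun a h => hG.acyclic _ h⟩
  obtain ⟨w, -, hw⟩ := (Finite.wellFounded_of_trans_of_irrefl r).has_min Set.univ
    ⟨⟨_, hK.choose_spec⟩, trivial⟩
  exact ⟨w.1, w.2, fun u hu h => hw ⟨u, hu⟩ trivial h⟩

variable {Ω : Type*} {E : Fin m → Type*} [∀ i, MeasurableSpace (E i)]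
  [MeasurableSpace Ω] [StandardBorelSpace Ω] {μ : Measure Ω} [IsFiniteMeasure μ]
  {X : (v : Node m) → Ω → E v.1} {hX : ∀ v, Measurable (X v)}

/-- Let `A` be a set of variables of time `s` such that every family (a variable of `K` together
with its parents) which meets `A` is contained in `A ∪ S`. Then `A` is independent of the remaining
variables given `S`. -/
lemma ci_of_families (hG : IsTsDAG G) (hM : LocalMarkov μ hX G) {s : ℤ} {base : Finset (Node m)}
    (hbase : ∀ u ∈ base, u.2 < s) {A S : Set (Node m)} (hA : ∀ u ∈ A, u.2 = s)
    (hAS : ∀ u ∈ A, u ∉ S) (K : Finset (Node m)) (hK : ∀ w ∈ K, w.2 = s)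
    (hcl : ∀ w ∈ K, ∀ u, G u w → u ∈ base ∪ K)
    (hfam : ∀ w ∈ K, insert w (parents G w) ⊆ A ∪ S ∨ ∀ u ∈ insert w (parents G w), u ∉ A) :
    CI μ hX (A ∩ K) (((base ∪ K : Finset (Node m)) \ A) \ S)
      (S ∩ (base ∪ K : Finset (Node m))) := by
  induction hn : K.card generalizing K with
  | zero =>
    obtain rfl := Finset.card_eq_zero.1 hn
    simpa using CI.empty_left
  | succ n ih =>
    -- A sink `w` of `K` is peeled off. It is nobody's parent in `K`, so the remaining set is still
    -- closed under parents up to `base`, and nothing in `base ∪ K'` descends from `w`.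
    obtain ⟨w, hwK, hmax⟩ := exists_maximal_of_acyclic hG (K := K)
      (Finset.card_pos.1 (by omega))
    obtain ⟨K', hwK', rfl⟩ : ∃ K', w ∉ K' ∧ insert w K' = K :=
      ⟨K.erase w, Finset.notMem_erase _ _, Finset.insert_erase hwK⟩
    have hws : w.2 = s := hK w hwK
    have hwb : w ∉ base := fun h => (hbase w h).ne hws
    have hpa : ∀ v ∈ insert w K', ∀ u, G u v → u ∈ base ∪ K' := by
      intro v hv u huv
      have h1 := hcl v hv u huv
      have h2 : u ≠ w := by rintro rfl; exact hmax v hv (.single huv)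
      simp only [Finset.mem_union, Finset.mem_insert] at h1 ⊢
      tauto
    have IH := ih K' (fun v hv => hK v (Finset.mem_insert_of_mem hv))
      (fun v hv => hpa v (Finset.mem_insert_of_mem hv))
      (fun v hv => hfam v (Finset.mem_insert_of_mem hv))
      (by rw [Finset.card_insert_of_notMem hwK'] at hn; omega)
    have hLM : CI μ hX {w} (base ∪ K' : Finset (Node m)) (parents G w) := by
      refine hM w _ fun u hu hd => ?_
      rcases Finset.mem_union.1 hu with hu | hu
      · exact absurd (hG.time_le_of_isDescendant hd) (by have := hbase u hu; omega)
      · rcases Relation.reflTransGen_iff_eq_or_transGen.1 hd with rfl | hd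
        · exact hwK' hu
        · exact hmax u (Finset.mem_insert_of_mem hu) hd
    have hpaw := hpa w (Finset.mem_insert_self _ _)
    set U : Finset (Node m) := base ∪ K' with hU
    have hU' : base ∪ insert w K' = insert w U := by rw [hU, Finset.union_insert]
    have hwU : w ∉ U := by simp [hU, hwb, hwK']
    have hAU : ∀ u ∈ A, u ∈ U → u ∈ K' := by
      intro u hu hu'
      rcases Finset.mem_union.1 hu' with h | h
      · exact absurd (hA u hu) (hbase u h).ne
      · exact h
    have hKU : ∀ u ∈ K', u ∈ U := fun u hu => Finset.mem_union_right _ hu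
    rw [hU', Finset.coe_insert, Finset.coe_insert]
    clear_value U
    rcases hfam w hwK with hf | hf
    -- The family of `w` is contained in `A ∪ S`, so the condition contains all parents of `w`.
    -- Contraction adds `w` to the side of `A`; if `w ∈ S`, weak union then moves it into the
    -- condition.
    · have h1 : CI μ hX {w} ((U \ A) \ S) (A ∩ K' ∪ S ∩ U) := by
        refine hLM.enlarge_cond (fun u hu => hu.1.1) ?_ ?_
        · intro u hu
          have hu' := hpaw u hu
          rcases hf (Set.mem_insert_of_mem _ hu) with h | h
          · exact .inl ⟨h, hAU u h hu'⟩
          · exact .inr ⟨h, hu'⟩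
        · rintro u (hu | hu)
          · exact .inl (hKU u hu.2)
          · exact .inl hu.2
      have h2 := CI.contraction IH.symm h1.symm
      rcases hf (Set.mem_insert _ _) with hw | hw
      · have e1 : (A ∩ insert w (K' : Set (Node m))) = {w} ∪ A ∩ K' := by
          ext u; by_cases hu : u = w <;> simp [hu, hw]
        have e2 : ((insert w (U : Set (Node m))) \ A) \ S = ((U : Set (Node m)) \ A) \ S := by
          ext u; by_cases hu : u = w <;> simp [hu, hw]
        have e3 : S ∩ insert w (U : Set (Node m)) = S ∩ U := by
          ext u; by_cases hu : u = w <;> simp [hu, hwU, hAS w hw]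
        rw [e1, e2, e3]
        exact h2.symm
      · have hwA : w ∉ A := fun h => hAS w h hw
        have e1 : (A ∩ insert w (K' : Set (Node m))) = A ∩ K' := by
          ext u; by_cases hu : u = w <;> simp [hu, hwA]
        have e2 : ((insert w (U : Set (Node m))) \ A) \ S = ((U : Set (Node m)) \ A) \ S := by
          ext u; by_cases hu : u = w <;> simp [hu, hw]
        have e3 : S ∩ insert w (U : Set (Node m)) = {w} ∪ S ∩ U := by
          ext u; by_cases hu : u = w <;> simp [hu, hw]
        rw [e1, e2, e3]
        rw [Set.union_comm] at h2
        exact h2.weak_union.symm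
    -- The mirror case: no member of the family is in `A`, and `w` joins the other side or the
    -- condition.
    · have hwA : w ∉ A := hf w (Set.mem_insert _ _)
      have h1 : CI μ hX {w} (A ∩ K') ((U \ A) \ S ∪ S ∩ U) := by
        refine hLM.enlarge_cond (fun u hu => hKU u hu.2) ?_ ?_
        · intro u hu
          have hu' := hpaw u hu
          by_cases h : u ∈ S
          · exact .inr ⟨h, hu'⟩
          · exact .inl ⟨⟨hu', hf u (Set.mem_insert_of_mem _ hu)⟩, h⟩
        · rintro u (hu | hu)
          · exact .inl hu.1.1
          · exact .inl hu.2
      have h2 := CI.contraction IH h1.symm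
      have e1 : (A ∩ insert w (K' : Set (Node m))) = A ∩ K' := by
        ext u; by_cases hu : u = w <;> simp [hu, hwA]
      rw [e1]
      by_cases hw : w ∈ S
      · have e2 : ((insert w (U : Set (Node m))) \ A) \ S = ((U : Set (Node m)) \ A) \ S := by
          ext u; by_cases hu : u = w <;> simp [hu, hw]
        have e3 : S ∩ insert w (U : Set (Node m)) = {w} ∪ S ∩ U := by
          ext u; by_cases hu : u = w <;> simp [hu, hw]
        rw [e2, e3]
        rw [Set.union_comm] at h2
        exact h2.weak_union
      · have e2 : ((insert w (U : Set (Node m))) \ A) \ S = {w} ∪ ((U : Set (Node m)) \ A) \ S := by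
          ext u; by_cases hu : u = w <;> simp [hu, hw, hwA]
        have e3 : S ∩ insert w (U : Set (Node m)) = S ∩ U := by
          ext u; by_cases hu : u = w <;> simp [hu, hw]
        rw [e2, e3]
        exact h2

/-- If `P` consists of all variables of the `τ` time steps before `s` and some variables of
time `s`, and `v` is d-separated from `P \ S` given `S ⊆ P`, then `v` is independent of `P \ S` and
of any further variables of the past given `S`. -/
lemma ci_of_dSep (hG : IsTsDAG G) (hM : LocalMarkov μ hX G) {τ : ℕ} (hlag : HasMaxLag G τ)
    {v : Node m} {P S F : Finset (Node m)}
    (hL : ∀ u : Node m, v.2 - τ ≤ u.2 → u.2 < v.2 → u ∈ P) (hP : ∀ u ∈ P, u.2 ≤ v.2)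
    (hv : v ∉ P) (hS : S ⊆ P) (hF : ∀ u ∈ F, u.2 < v.2)
    (hsep : DSep G {v} ((P \ S : Finset (Node m)) : Set (Node m)) S) :
    CI μ hX {v} (P ∪ F : Finset (Node m)) S := by
  classical
  have hvS : v ∉ S := fun h => hv (hS h)
  -- The contemporaneous part of the ancestral set of `v` and `P`. It is finite, and by the lag
  -- bound its parents outside it belong to `P`.
  let K : Finset (Node m) := (Finset.univ.image fun i : Fin m => ((i, v.2) : Node m)).filter
    fun w => ∃ y ∈ insert v P, IsDescendant G w y
  have hK : ∀ w, w ∈ K ↔ w.2 = v.2 ∧ ∃ y ∈ insert v P, IsDescendant G w y := by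
    intro w
    simp only [K, Finset.mem_filter, Finset.mem_image, Finset.mem_univ, true_and]
    refine and_congr_left fun _ => ⟨?_, fun h => ⟨w.1, by rw [← h]⟩⟩
    rintro ⟨i, rfl⟩; rfl
  let base : Finset (Node m) := (P.filter fun u => u.2 < v.2) ∪ F
  have hbase : ∀ u ∈ base, u.2 < v.2 := by
    intro u hu
    rcases Finset.mem_union.1 hu with h | h
    · exact (Finset.mem_filter.1 h).2
    · exact hF u h
  -- The part of time `v.2` that is d-connected to `v`. Separation by `S` in the moral graph becomes
  -- the hypothesis on families.
  let A : Set (Node m) := {w | w.2 = v.2 ∧ DConnected G S v w}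
  have hpast : ∀ u w, G u w → w.2 = v.2 → u.2 < v.2 → u ∈ P := by
    intro u w huw hw hu
    exact hL u (by have := hlag u w huw; omega) hu
  have hAP : ∀ u, DConnected G S v u → u ∉ P := by
    intro u hu huP
    exact hsep.not_dConnected rfl
      (by simpa using ⟨huP, by simpa using hu.right_notMem⟩) hu
  have hcl : ∀ w ∈ K, ∀ u, G u w → u ∈ base ∪ K := by
    intro w hw u huw
    obtain ⟨hws, y, hy, hwy⟩ := (hK w).1 hw
    rcases lt_or_eq_of_le (hG.time_order u w huw) with h | h
    · rw [hws] at h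
      exact Finset.mem_union_left _ (Finset.mem_union_left _
        (Finset.mem_filter.2 ⟨hpast u w huw hws h, h⟩))
    · exact Finset.mem_union_right _ ((hK u).2 ⟨h.trans hws, y, hy, .head huw hwy⟩)
  have hfam : ∀ w ∈ K, insert w (parents G w) ⊆ A ∪ S ∨
      ∀ u ∈ insert w (parents G w), u ∉ A := by
    intro w hw
    by_contra! hcon
    obtain ⟨hnot, x, hx, hxA⟩ := hcon
    obtain ⟨hws, y, hy, hwy⟩ := (hK w).1 hw
    -- A d-connected parent from the past would lie in `P`, contrary to `hAP`; so d-connection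
    -- cannot leave the present time step.
    have toA : ∀ u ∈ insert w (parents G w), DConnected G S v u → u ∈ A := by
      intro u hu hc
      refine ⟨?_, hc⟩
      rcases hu with rfl | hu
      · exact hws
      · by_contra hne
        have h1 := hG.time_order u w hu
        exact hAP u hc (hpast u w hu hws (by omega))
    have hconn : w ∉ S → DConnected G S v w := by
      intro hwS
      rcases hx with rfl | hx
      · exact hxA.2
      · exact hxA.2.child hG hx (by simpa using hwS)
    refine hnot fun u hu => ?_
    by_cases huS : u ∈ S
    · exact .inr huS
    refine .inl (toA u hu ?_)
    rcases hu with rfl | hu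
    · exact hconn huS
    by_cases hwS : w ∈ S
    · rcases hx with rfl | hx
      · exact absurd hwS (by simpa using hxA.2.right_notMem)
      · exact hxA.2.spouse hG hx hu hwS (by simpa using huS)
    have hcw := hconn hwS
    by_cases hd : ∃ z ∈ (S : Set (Node m)), IsDescendant G w z
    · exact hcw.parent_of_ancestor hu (by simpa using huS) hd
    push Not at hd
    -- Now `w` is no open collider, but it is an ancestor of `v` or of some `y ∈ P`. In the first
    -- case a directed path supplies another trail, in the second `y` would be d-connected to `v`.
    rcases Finset.mem_insert.1 hy with rfl | hyP
    · exact dConnected_parent_of_isDescendant hG hwy hd hu (by simpa using huS)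
    · exact absurd hyP (hAP y (hcw.descendant hG hd hwy))
  have main := ci_of_families hG hM hbase (A := A) (S := S) (fun u hu => hu.1)
    (fun u hu => hu.2.right_notMem) K (fun w hw => ((hK w).1 hw).1) hcl hfam
  have hPU : ∀ u ∈ P, u ∈ base ∪ K := by
    intro u hu
    rcases lt_or_eq_of_le (hP u hu) with h | h
    · exact Finset.mem_union_left _ (Finset.mem_union_left _ (Finset.mem_filter.2 ⟨hu, h⟩))
    · exact Finset.mem_union_right _ ((hK u).2 ⟨h, u, Finset.mem_insert_of_mem hu, .refl⟩)
  have hSU : (S : Set (Node m)) ∩ (base ∪ K : Finset (Node m)) = S :=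
    Set.inter_eq_left.2 fun u hu => hPU u (hS hu)
  rw [hSU] at main
  refine (main.mono_left ?_).union_cond.mono_right ?_
  · rintro _ rfl
    exact ⟨⟨rfl, .refl (by simpa using hvS)⟩,
      (hK _).2 ⟨rfl, _, Finset.mem_insert_self _ _, .refl⟩⟩
  · intro u hu
    by_cases huS : u ∈ (S : Set (Node m))
    · exact .inr huS
    refine .inl ⟨⟨?_, fun hA => ?_⟩, huS⟩
    · rcases Finset.mem_union.1 hu with h | h
      · exact hPU u h
      · exact Finset.mem_union_left _ (Finset.mem_union_right _ h)
    · rcases Finset.mem_union.1 hu with h | h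
      · exact hAP u hA.2 h
      · exact (hF u h).ne hA.1

end GlobalMarkov

/-! ## Time shifts -/

section Shift

variable {m : ℕ} {G : TsGraph m}

/-- The time shift by `r` of a node. -/
def shiftNode (r : ℤ) (v : Node m) : Node m := (v.1, v.2 + r)

lemma shiftNode_neg (r : ℤ) (v : Node m) : shiftNode (-r) (shiftNode r v) = v :=
  Prod.ext rfl (by simp [shiftNode])

lemma RepeatingEdges.shift (hG : RepeatingEdges G) {u v : Node m} (r : ℤ) :
    G (shiftNode r u) (shiftNode r v) ↔ G u v :=
  (hG u.1 v.1 u.2 v.2 r).symm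

lemma RepeatingEdges.isDescendant_shift (hG : RepeatingEdges G) {u v : Node m} (r : ℤ)
    (h : IsDescendant G u v) : IsDescendant G (shiftNode r u) (shiftNode r v) :=
  by
  induction h with
  | refl => exact .refl
  | tail _ h ih => exact ih.tail ((hG.shift r).2 h)

lemma shiftNode_mem_image {r : ℤ} {v : Node m} {Z : Set (Node m)} :
    shiftNode r v ∈ shiftNode r '' Z ↔ v ∈ Z :=
  (Function.LeftInverse.injective (shiftNode_neg r)).mem_set_image

lemma RepeatingEdges.dConnected_shift (hG : RepeatingEdges G) {Z : Set (Node m)} {v w : Node m}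
    (r : ℤ) (h : DConnected G Z v w) :
    DConnected G (shiftNode r '' Z) (shiftNode r v) (shiftNode r w) := by
  obtain ⟨k, p, rfl, rfl, h1, h2, h3, h4⟩ := h
  refine ⟨k, fun j => shiftNode r (p j), rfl, rfl, ?_, ?_, ?_, ?_⟩
  · simpa only [hG.shift] using h1
  · simpa only [shiftNode_mem_image] using h2
  · simpa only [shiftNode_mem_image] using h3
  · intro j hj
    simp only [hG.shift, shiftNode_mem_image]
    refine ⟨fun hc => ?_, (h4 j hj).2⟩
    obtain ⟨z, hz, hd⟩ := (h4 j hj).1 hc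
    exact ⟨_, Set.mem_image_of_mem _ hz, hG.isDescendant_shift r hd⟩

lemma shiftNode_place {τ : ℕ} (s t : ℤ) (w : WNode m τ) :
    shiftNode (s - t) (place t w) = place s w :=
  Prod.ext rfl (by simp [shiftNode, place])

lemma place_injective {τ : ℕ} (t : ℤ) : Function.Injective (place t : WNode m τ → Node m) := by
  intro a b h
  have h1 : (place t a).1 = (place t b).1 := by rw [h]
  have h2 : (place t a).2 = (place t b).2 := by rw [h]
  simp only [place] at h1 h2
  exact Prod.ext h1 (Fin.ext (by omega))

lemma RepeatingEdges.dConnected_place (hG : RepeatingEdges G) {τ : ℕ} {Z : Set (WNode m τ)}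
    {v w : WNode m τ} {s : ℤ} (t : ℤ) (h : DConnected G (place s '' Z) (place s v) (place s w)) :
    DConnected G (place t '' Z) (place t v) (place t w) := by
  have := hG.dConnected_shift (t - s) h
  rwa [shiftNode_place, shiftNode_place, Set.image_image, funext (shiftNode_place t s)] at this

end Shift

/-! ## Conditional independencies of the contemporaneous variables of a window -/

section Window

variable {m τ : ℕ} {G : TsGraph m} {Ω : Type*} {E : Fin m → Type*} [∀ i, MeasurableSpace (E i)]
  [MeasurableSpace Ω] [StandardBorelSpace Ω] {μ : Measure Ω} [IsFiniteMeasure μ]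
  {X : (v : Node m) → Ω → E v.1} {hX : ∀ v, Measurable (X v)}

/-- The conditional independence of two window variables, given a set of window variables, where
the window ends at time `t`. -/
def WindowCI (μ : Measure Ω) [IsFiniteMeasure μ] {X : (v : Node m) → Ω → E v.1}
    (hX : ∀ v, Measurable (X v)) (t : ℤ) (v a : WNode m τ) (S : Finset (WNode m τ)) : Prop :=
  CI μ hX {place t v} {place t a} (place t '' (S : Set (WNode m τ)))

/-- The time series is generated by a ts-DAG that has the local Markov property, is faithful, has
time lags at most `τ` and is invariant under time shifts. -/
structure IsFaithfulModel (μ : Measure Ω) [IsFiniteMeasure μ] {X : (v : Node m) → Ω → E v.1}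
    (hX : ∀ v, Measurable (X v)) (G : TsGraph m) (τ : ℕ) : Prop where
  dag : IsTsDAG G
  markov : LocalMarkov μ hX G
  faithful : Faithful μ hX G
  lag : HasMaxLag G τ
  repeating : RepeatingEdges G

/-- A possible set of predecessors of a contemporaneous variable `X^i_t`: it contains all lagged
variables. -/
structure IsPrefix (i : Fin m) (P : Finset (WNode m τ)) : Prop where
  lagged_mem : ∀ u : WNode m τ, u.2 ≠ 0 → u ∈ P
  self_notMem : ((i, 0) : WNode m τ) ∉ P

/-- Pairwise independence given `S` at one time implies joint independence given `S` at all times,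
also of additional variables of the past. -/
lemma IsFaithfulModel.ci_prefix (hG : IsFaithfulModel μ hX G τ) {i : Fin m}
    {P S : Finset (WNode m τ)} (hP : IsPrefix i P) (hS : S ⊆ P) {t : ℤ}
    (h : ∀ a ∈ P \ S, WindowCI μ hX t (i, 0) a S) (s : ℤ) (F : Finset (Node m))
    (hF : ∀ u ∈ F, u.2 < s) :
    CI μ hX {place s ((i, 0) : WNode m τ)}
      (place s '' (P : Set (WNode m τ)) ∪ (F : Set (Node m)))
      (place s '' (S : Set (WNode m τ))) := by
  classical
  have htime : (place s ((i, 0) : WNode m τ)).2 = s := by simp [place]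
  have key := ci_of_dSep hG.dag hG.markov hG.lag (hX := hX) (v := place s ((i, 0) : WNode m τ))
    (P := P.image (place s)) (S := S.image (place s)) (F := F) ?_ ?_ ?_ ?_ ?_ ?_
  · simpa using key
  · intro u hu1 hu2
    rw [htime] at hu1 hu2
    obtain ⟨n, hn⟩ := Int.eq_ofNat_of_zero_le (a := s - u.2) (by omega)
    refine Finset.mem_image.2 ⟨(u.1, ⟨n, by omega⟩), hP.lagged_mem _ ?_, ?_⟩
    · intro h0
      have : n = 0 := congrArg Fin.val h0
      omega
    · exact Prod.ext rfl (by simp only [place]; omega)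
  · intro u hu
    obtain ⟨w, -, rfl⟩ := Finset.mem_image.1 hu
    rw [htime]; simp [place]
  · intro hv
    obtain ⟨w, hw, he⟩ := Finset.mem_image.1 hv
    exact hP.self_notMem (place_injective s he ▸ hw)
  · exact Finset.image_subset_image hS
  · rwa [htime]
  · rw [dSep_iff]
    rintro _ rfl w hw hc
    rw [← Finset.image_sdiff _ _ (place_injective s)] at hw
    obtain ⟨a, ha, rfl⟩ := Finset.mem_image.1 (Finset.mem_coe.1 hw)
    rw [Finset.coe_image] at hc
    -- It is the active trail that is shifted from `s` to `t`, since conditional independencies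
    -- cannot be shifted directly.
    have hc' := hG.repeating.dConnected_place t hc
    have hne : ((i, 0) : WNode m τ) ≠ a := by
      rintro rfl; exact hP.self_notMem (Finset.mem_sdiff.1 ha).1
    have hsep := hG.faithful {place t ((i, 0) : WNode m τ)} {place t a} (S.image (place t))
      (by simpa using fun h => hne (place_injective t h))
      (by
        rw [Finset.disjoint_singleton_left, (place_injective t).mem_finset_image]
        exact fun h => hP.self_notMem (hS h))
      (by
        rw [Finset.disjoint_singleton_left, (place_injective t).mem_finset_image]
        exact (Finset.mem_sdiff.1 ha).2)
      (by simpa [WindowCI] using h a ha)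
    rw [Finset.coe_singleton, Finset.coe_singleton, Finset.coe_image] at hsep
    exact hsep.not_dConnected rfl rfl hc'

/-- A redundant element of a separating set can be deleted, and the result is again separating. -/
lemma IsFaithfulModel.windowCI_erase (hG : IsFaithfulModel μ hX G τ) {i : Fin m}
    {P S : Finset (WNode m τ)} (hP : IsPrefix i P) (hS : S ⊆ P) {s t : ℤ}
    (h : ∀ a ∈ P \ S, WindowCI μ hX t (i, 0) a S) {a : WNode m τ} (ha : a ∈ S)
    (hCI : WindowCI μ hX s (i, 0) a (S.erase a)) :
    ∀ b ∈ P \ S.erase a, WindowCI μ hX s (i, 0) b (S.erase a) := by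
  intro b hb
  -- Separation is known at time `t`, redundancy of `a` at time `s`; contraction needs both at the
  -- same time.
  have hj := hG.ci_prefix hP hS h s ∅ (by simp)
  rw [Finset.coe_empty, Set.union_empty] at hj
  have he : place s '' (S : Set (WNode m τ)) =
      {place s a} ∪ place s '' ((S.erase a : Finset (WNode m τ)) : Set (WNode m τ)) := by
    rw [← Finset.insert_erase ha, Finset.coe_insert, Set.image_insert_eq]; simp
  rw [he] at hj
  exact (CI.contraction hCI hj).mono_right
    (Set.singleton_subset_iff.2 (.inl (Set.mem_image_of_mem _ (Finset.mem_sdiff.1 hb).1)))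

end Window

/-! ## Grow–shrink trees return Markov boundaries -/

section GrowShrinkTree

variable {m τ : ℕ}

lemma improvingAdditions_eq_empty {loc : LocalScore m τ} {v : WNode m τ}
    {P S : Finset (WNode m τ)} (h : ¬ (bestAdditions loc v P S).Nonempty) :
    improvingAdditions loc v P S = ∅ := by
  by_contra hne
  obtain ⟨a, ha, hmax⟩ := (improvingAdditions loc v P S).exists_max_image
    (fun a => loc v (insert a S)) (Finset.nonempty_iff_ne_empty.2 hne)
  exact h ⟨a, Finset.mem_filter.2 ⟨ha, hmax⟩⟩

lemma grow_spec (loc : LocalScore m τ) (R : SelectionRule (WNode m τ)) (v : WNode m τ)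
    (P S : Finset (WNode m τ)) (hS : S ⊆ P) :
    grow loc R v P S ⊆ P ∧ improvingAdditions loc v P (grow loc R v P S) = ∅ := by
  induction S using grow.induct (loc := loc) (R := R) (v := v) (P := P) with
  | case1 S h ih =>
    rw [grow, dif_pos h]
    exact ih (Finset.insert_subset
      (Finset.mem_sdiff.1 (pick_bestAdditions_mem loc R v P S h)).1 hS)
  | case2 S h =>
    rw [grow, dif_neg h]
    exact ⟨hS, improvingAdditions_eq_empty h⟩

lemma shrink_spec (loc : LocalScore m τ) (R : SelectionRule (WNode m τ)) (v : WNode m τ)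
    (S : Finset (WNode m τ)) (Q : Finset (WNode m τ) → Prop) (hS : Q S)
    (hQ : ∀ S a, Q S → a ∈ improvingDeletions loc v S → Q (S.erase a)) :
    Q (shrink loc R v S) ∧ improvingDeletions loc v (shrink loc R v S) = ∅ := by
  induction S using shrink.induct (loc := loc) (R := R) (v := v) with
  | case1 S h ih =>
    rw [shrink, dif_pos h]
    exact ih (hQ _ _ hS (R.pick_mem v S _ h))
  | case2 S h =>
    rw [shrink, dif_neg h]
    exact ⟨hS, Finset.not_nonempty_iff_eq_empty.1 h⟩

lemma gstParents_subset (loc : LocalScore m τ) (Rg Rs : SelectionRule (WNode m τ))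
    (v : WNode m τ) (P : Finset (WNode m τ)) : gstParents loc Rg Rs v P ⊆ P :=
  (shrink_spec loc Rs v _ (· ⊆ P) (grow_spec loc Rg v P ∅ (Finset.empty_subset _)).1
    fun _ _ h _ => (Finset.erase_subset _ _).trans h).1

variable {G : TsGraph m} {Ω : Type*} {E : Fin m → Type*} [∀ i, MeasurableSpace (E i)]
  [MeasurableSpace Ω] [StandardBorelSpace Ω] {μ : Measure Ω} [IsFiniteMeasure μ]
  {X : (v : Node m) → Ω → E v.1} {hX : ∀ v, Measurable (X v)} {t : ℤ}

/-- The local scores compare a parent set with and without an additional parent in accordance with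
the conditional independencies of the window variables. -/
def ScoreReflectsCI (μ : Measure Ω) [IsFiniteMeasure μ] {X : (v : Node m) → Ω → E v.1}
    (hX : ∀ v, Measurable (X v)) (t : ℤ) (loc : LocalScore m τ) : Prop :=
  ∀ (v a : WNode m τ) (S : Finset (WNode m τ)), a ∉ S → v ∉ insert a S →
    (¬ WindowCI μ hX t v a S → loc v S < loc v (insert a S)) ∧
    (WindowCI μ hX t v a S → loc v (insert a S) < loc v S)

/-- When no addition improves the score, the set separates; improving deletions are exactly those of
redundant parents, and they preserve separation. The order of additions and deletions plays no role.
-/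
lemma gstParents_markovBoundary (hG : IsFaithfulModel μ hX G τ) {loc : LocalScore m τ}
    (hloc : ScoreReflectsCI μ hX t loc) (Rg Rs : SelectionRule (WNode m τ)) {i : Fin m}
    {P : Finset (WNode m τ)} (hP : IsPrefix i P) :
    (∀ a ∈ P \ gstParents loc Rg Rs (i, 0) P,
      WindowCI μ hX t (i, 0) a (gstParents loc Rg Rs (i, 0) P)) ∧
    ∀ a ∈ gstParents loc Rg Rs (i, 0) P,
      ¬ WindowCI μ hX t (i, 0) a ((gstParents loc Rg Rs (i, 0) P).erase a) := by
  obtain ⟨hg1, hg2⟩ := grow_spec loc Rg (i, 0) P ∅ (Finset.empty_subset _)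
  have hself : ∀ S ⊆ P, ∀ a ∈ P, ((i, 0) : WNode m τ) ∉ insert a S := by
    intro S hS a ha h
    rcases Finset.mem_insert.1 h with h | h
    · exact hP.self_notMem (h ▸ ha)
    · exact hP.self_notMem (hS h)
  have hdel : ∀ S ⊆ P, ∀ a ∈ S, (a ∈ improvingDeletions loc (i, 0) S ↔
      WindowCI μ hX t (i, 0) a (S.erase a)) := by
    intro S hS a ha
    have h := hloc (i, 0) a (S.erase a) (Finset.notMem_erase _ _)
      (hself _ ((Finset.erase_subset _ _).trans hS) a (hS ha))
    rw [Finset.insert_erase ha] at h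
    simp only [improvingDeletions, Finset.mem_filter, ha, true_and]
    refine ⟨fun hlt => ?_, h.2⟩
    by_contra hn
    exact lt_asymm hlt (h.1 hn)
  obtain ⟨⟨hs1, hs2⟩, hs3⟩ := shrink_spec loc Rs (i, 0) (grow loc Rg (i, 0) P ∅)
    (fun S => S ⊆ P ∧ ∀ a ∈ P \ S, WindowCI μ hX t (i, 0) a S)
    ⟨hg1, fun a ha => by
      by_contra hn
      have hlt := (hloc (i, 0) a _ (Finset.mem_sdiff.1 ha).2
        (hself _ hg1 a (Finset.mem_sdiff.1 ha).1)).1 hn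
      exact Finset.notMem_empty a (hg2 ▸ Finset.mem_filter.2 ⟨ha, hlt⟩)⟩
    (fun S a hS ha => ⟨(Finset.erase_subset _ _).trans hS.1,
      have haS : a ∈ S := (Finset.mem_filter.1 ha).1
      hG.windowCI_erase hP hS.1 hS.2 haS ((hdel S hS.1 a haS).1 ha)⟩)
  refine ⟨hs2, fun a ha hCI => ?_⟩
  exact Finset.notMem_empty a (hs3 ▸ (hdel _ hs1 a ha).2 hCI)

end GrowShrinkTree

/-! ## From the ordered Markov property to the local Markov property -/

section OrderedMarkov

variable {m : ℕ} {Ω : Type*} {E : Fin m → Type*} [∀ i, MeasurableSpace (E i)]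
  [MeasurableSpace Ω] [StandardBorelSpace Ω] {μ : Measure Ω} [IsFiniteMeasure μ]
  {X : (v : Node m) → Ω → E v.1} {hX : ∀ v, Measurable (X v)}

lemma rank_le_of_isDescendant {H : TsGraph m} {rk : Node m → ℤ}
    (hrk : ∀ u v, H u v → rk u < rk v) {u v : Node m} (h : IsDescendant H u v) : rk u ≤ rk v := by
  induction h with
  | refl => exact le_rfl
  | tail _ h ih => exact ih.trans (hrk _ _ h).le

/-- Induction on how far the ranks in `I` exceed that of `v`. By injectivity a single `w` has top
rank; given its parents it is independent of everything lower, including `v`, so contraction adds it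
to the others. -/
lemma localMarkov_of_ordered {H : TsGraph m} {rk : Node m → ℤ} (hinj : Function.Injective rk)
    (hrk : ∀ u v, H u v → rk u < rk v) (hfin : ∀ v, (parents H v).Finite)
    (hM : ∀ (v : Node m) (Q : Finset (Node m)), (∀ u ∈ Q, rk u < rk v) →
      CI μ hX {v} Q (parents H v)) : LocalMarkov μ hX H := by
  classical
  intro v
  have main : ∀ (n : ℕ) (I : Finset (Node m)), (∀ w ∈ I, ¬ IsDescendant H v w) →
      (∀ w ∈ I, rk w ≤ rk v + n) → CI μ hX {v} I (parents H v) := by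
    intro n
    induction n with
    | zero =>
      intro I hI hle
      refine hM v I fun w hw => lt_of_le_of_ne (by simpa using hle w hw) fun he => ?_
      exact hI w hw (hinj he ▸ .refl)
    | succ n ih =>
      intro I hI hle
      by_cases hw : ∃ w ∈ I, rk w = rk v + (n + 1 : ℕ)
      swap
      · push Not at hw
        refine ih I hI fun w hwI => ?_
        have := hle w hwI
        have := hw w hwI
        push_cast at *
        omega
      obtain ⟨w, hwI, hwr⟩ := hw
      push_cast at hwr hle
      -- The parents of `w` and `v` are included so that they can be part of the condition for `w`.
      -- This is harmless: they have lower rank than `w` and do not descend from `v`.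
      let I' : Finset (Node m) := I.erase w ∪ (hfin w).toFinset ∪ (hfin v).toFinset
      have hI' : ∀ u, u ∈ I' ↔ (u ≠ w ∧ u ∈ I ∨ H u w) ∨ H u v := by
        intro u; simp [I', parents, or_assoc]
      have hlt : ∀ u ∈ I', rk u ≤ rk v + n := by
        intro u hu
        rcases (hI' u).1 hu with (⟨hne, hu⟩ | hu) | hu
        · have h1 := hle u hu
          have h2 : rk u ≠ rk w := fun h => hne (hinj h)
          omega
        · have := hrk u w hu; omega
        · have := hrk u v hu; omega
      have h1 : CI μ hX {v} I' (parents H v) := by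
        refine ih I' (fun u hu hd => ?_) hlt
        rcases (hI' u).1 hu with (⟨-, hu⟩ | hu) | hu
        · exact hI u hu hd
        · exact hI w hwI (hd.tail hu)
        · exact absurd (rank_le_of_isDescendant hrk hd) (hrk u v hu).not_ge
      have h2 : CI μ hX {w} (insert v I' : Finset (Node m)) (parents H w) := by
        refine hM w _ fun u hu => ?_
        rcases Finset.mem_insert.1 hu with rfl | hu
        · omega
        · have := hlt u hu; omega
      have h3 : CI μ hX {w} {v} (I' ∪ parents H v) := by
        refine h2.enlarge_cond (by simp) (fun u hu => .inl ((hI' u).2 (.inl (.inr hu)))) ?_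
        rintro u (hu | hu)
        · exact .inl (by simpa using .inr hu)
        · exact .inl (by simpa using .inr ((hI' u).2 (.inr hu)))
      refine (h1.contraction h3.symm).mono_right fun u hu => ?_
      by_cases hne : u = w
      · exact .inl hne
      · exact .inr ((hI' u).2 (.inl (.inl ⟨hne, hu⟩)))
  intro I hI
  obtain ⟨n, hn⟩ : ∃ n : ℕ, ∀ w ∈ I, rk w ≤ rk v + n := by
    obtain ⟨M, hM'⟩ := (I.image rk).bddAbove
    refine ⟨(M - rk v).toNat, fun w hw => ?_⟩
    have : rk w ≤ M := hM' (by simpa using ⟨_, _, hw, rfl⟩)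
    have := Int.self_le_toNat (M - rk v)
    omega
  exact main n I hI hn

end OrderedMarkov

/-! ## The permutations visited by the search -/

section Permutations

variable {m τ : ℕ}

/-- True for absent elements as well, because `idxOf` then returns the length of the list. -/
lemma mem_takeWhile_ne_iff {α : Type*} [DecidableEq α] [BEq α] [LawfulBEq α] {u v : α} {l : List α} :
    u ∈ l.takeWhile (fun w => w ≠ v) ↔ l.idxOf u < l.idxOf v := by
  induction l with
  | nil => simp
  | cons a l ih =>
    by_cases hav : a = v
    · subst hav; simp
    · rw [List.takeWhile_cons_of_pos (by simpa using hav), List.idxOf_cons_ne _ hav]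
      by_cases hau : a = u
      · subst hau; simp
      · rw [List.idxOf_cons_ne _ hau, List.mem_cons, ih]
        simp [Ne.symm hau]

lemma mem_prefixOf_iff {π : List (WNode m τ)} {u v : WNode m τ} :
    u ∈ prefixOf π v ↔ π.idxOf u < π.idxOf v := by
  rw [prefixOf, List.mem_toFinset, mem_takeWhile_ne_iff]

lemma insertIdx_length_append {α : Type*} (l₁ l₂ : List α) (k : ℕ) (a : α) :
    (l₁ ++ l₂).insertIdx (l₁.length + k) a = l₁ ++ l₂.insertIdx k a := by
  induction l₁ with
  | nil => simp
  | cons b l ih => rw [List.length_cons, Nat.add_right_comm, List.cons_append,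
      List.insertIdx_succ_cons, ih, List.cons_append]

/-- The lagged variables in the order of the initial permutation. -/
def laggedVars (m τ : ℕ) : List (WNode m τ) :=
  ((List.finRange τ).map Fin.succ).reverse.flatMap fun ℓ => (List.finRange m).map fun i => (i, ℓ)

/-- The contemporaneous variables. -/
def contempVars (m τ : ℕ) : List (WNode m τ) := (List.finRange m).map fun i => (i, 0)

lemma mem_laggedVars {u : WNode m τ} : u ∈ laggedVars m τ ↔ u.2 ≠ 0 := by
  simp only [laggedVars, List.mem_flatMap, List.mem_reverse, List.mem_map, List.mem_finRange,
    true_and]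
  constructor
  · rintro ⟨_, ⟨a, rfl⟩, i, rfl⟩
    exact Fin.succ_ne_zero a
  · intro h
    obtain ⟨a, ha⟩ := Fin.exists_succ_eq.2 h
    exact ⟨u.2, ⟨a, ha⟩, u.1, rfl⟩

lemma length_laggedVars : (laggedVars m τ).length = m * τ := by
  simp [laggedVars, List.length_flatMap, Function.comp_def, mul_comm]

lemma mem_contempVars (i : Fin m) : (i, 0) ∈ contempVars m τ := by
  simp [contempVars]

/-- The permutation consists of the lagged variables, in the initial order, followed by the
contemporaneous variables. -/
def IsAdmissible (π : List (WNode m τ)) : Prop :=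
  ∃ l, π = laggedVars m τ ++ l ∧ l.Perm (contempVars m τ)

lemma isAdmissible_initPerm : IsAdmissible (initPerm m τ) := by
  refine ⟨contempVars m τ, ?_, .refl _⟩
  simp [initPerm, laggedVars, contempVars, List.finRange_succ]

namespace IsAdmissible

variable {π : List (WNode m τ)}

lemma contemp_mem (h : IsAdmissible π) (i : Fin m) : (i, 0) ∈ π := by
  obtain ⟨l, rfl, hl⟩ := h
  exact List.mem_append_right _ (hl.mem_iff.2 (mem_contempVars i))

lemma isPrefix (h : IsAdmissible π) (i : Fin m) : IsPrefix i (prefixOf π (i, 0)) where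
  lagged_mem u hu := by
    obtain ⟨l, rfl, hl⟩ := h
    have hi : ((i, 0) : WNode m τ) ∉ laggedVars m τ := fun h => mem_laggedVars.1 h rfl
    rw [mem_prefixOf_iff, List.idxOf_append_of_mem (mem_laggedVars.2 hu),
      List.idxOf_append_of_notMem hi]
    exact (List.idxOf_lt_length_iff.2 (mem_laggedVars.2 hu)).trans_le (Nat.le_add_right _ _)
  self_notMem := by rw [mem_prefixOf_iff]; exact lt_irrefl _

lemma moveTo (h : IsAdmissible π) (i : Fin m) {k : ℕ} (hk : k < m) :
    IsAdmissible (moveTo π (i, 0) (m * τ + k)) := by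
  obtain ⟨l, rfl, hl⟩ := h
  have hi : ((i, 0) : WNode m τ) ∉ laggedVars m τ := fun h => mem_laggedVars.1 h rfl
  have hmem : (i, 0) ∈ l := hl.mem_iff.2 (mem_contempVars i)
  have hlen : l.length = m := by rw [hl.length_eq]; simp [contempVars]
  refine ⟨(l.erase (i, 0)).insertIdx k (i, 0), ?_, ?_⟩
  · rw [_root_.moveTo, List.erase_append_right _ hi, ← length_laggedVars,
      insertIdx_length_append]
  · refine (List.perm_insertIdx _ _ ?_).trans ((List.perm_cons_erase hmem).symm.trans hl)
    -- After the erasure `m - 1` entries remain, so `k < m` keeps `insertIdx` from running past the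
    -- end, where it would lose the element.
    rw [List.length_erase_of_mem hmem, hlen]; omega

lemma bestTSMove (h : IsAdmissible π) (score : List (WNode m τ) → ℝ) (i : Fin m) :
    IsAdmissible (bestTSMove score π i) := by
  -- Loop invariant: the current list is admissible and the best position so far lies in the
  -- contemporaneous block.
  have key : ∀ (ks : List ℕ) (st : List (WNode m τ) × ℝ × ℕ), (∀ k ∈ ks, k < m) →
      (IsAdmissible st.1 ∧ ∃ k < m, st.2.2 = m * τ + k) →
      IsAdmissible (ks.foldl (bestTSMoveStep score (i, 0)) st).1 ∧
        ∃ k < m, (ks.foldl (bestTSMoveStep score (i, 0)) st).2.2 = m * τ + k := by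
    intro ks
    induction ks with
    | nil => intro st _ hst; exact hst
    | cons k ks ih =>
      intro st hks hst
      have hk : k < m := hks k (by simp)
      refine ih _ (fun k' hk' => hks k' (by simp [hk'])) ?_
      unfold bestTSMoveStep
      split
      · exact ⟨hst.1.moveTo i hk, k, hk, rfl⟩
      · exact ⟨hst.1.moveTo i hk, hst.2⟩
  have hstart : ∃ k < m, π.idxOf (i, 0) = m * τ + k := by
    obtain ⟨l, rfl, hl⟩ := h
    refine ⟨l.idxOf (i, 0), ?_, ?_⟩
    · have := List.idxOf_lt_length_iff.2 (hl.mem_iff.2 (mem_contempVars i))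
      rwa [hl.length_eq, contempVars, List.length_map, List.length_finRange] at this
    · rw [List.idxOf_append_of_notMem fun h => mem_laggedVars.1 h rfl, length_laggedVars]
  obtain ⟨h1, k, hk, h2⟩ := key (List.range m) (π, score π, π.idxOf (i, 0))
    (fun k hk => List.mem_range.1 hk) ⟨h, hstart⟩
  unfold _root_.bestTSMove
  simp only [h2]
  exact h1.moveTo i hk

lemma permSearch (h : IsAdmissible π) (loc : LocalScore m τ)
    (Rg Rs : SelectionRule (WNode m τ)) : IsAdmissible (permSearch loc Rg Rs π) := by
  induction π using permSearch.induct (loc := loc) (Rg := Rg) (Rs := Rs) with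
  | case1 π hπ =>
    rw [_root_.permSearch]
    split
    · exact h
    · simp_all
  | case2 π i hπ ih =>
    rw [_root_.permSearch]
    split
    · simp_all
    · rename_i j hj
      obtain rfl : i = j := by simpa using hπ.symm.trans hj
      exact ih (h.bestTSMove _ _)

end IsAdmissible

end Permutations

/-! ## The graph induced by a permutation -/

section Project

variable {m τ : ℕ} {loc : LocalScore m τ} {Rg Rs : SelectionRule (WNode m τ)}
  {π : List (WNode m τ)}

/-- The position of a node in the order by time and, for equal times, by the permutation `π`. -/
def permRank (π : List (WNode m τ)) (v : Node m) : ℤ :=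
  -- Since `idxOf` is at most the length, the factor `π.length + 1` lets time dominate.
  v.2 * (π.length + 1) + (π.idxOf ((v.1, 0) : WNode m τ) : ℕ)

lemma permRank_lt_of_time_lt {u v : Node m} (h : u.2 < v.2) : permRank π u < permRank π v := by
  have h1 : π.idxOf ((u.1, 0) : WNode m τ) ≤ π.length := List.idxOf_le_length
  have h2 : (u.2 + 1) * ((π.length : ℤ) + 1) ≤ v.2 * (π.length + 1) :=
    mul_le_mul_of_nonneg_right h (by positivity)
  unfold permRank
  zify at h1
  linarith [Int.natCast_nonneg (π.idxOf ((v.1, 0) : WNode m τ))]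

lemma permRank_lt_iff {u v : Node m} :
    permRank π u < permRank π v ↔ u.2 < v.2 ∨
      u.2 = v.2 ∧ π.idxOf ((u.1, 0) : WNode m τ) < π.idxOf ((v.1, 0) : WNode m τ) := by
  rcases lt_trichotomy u.2 v.2 with h | h | h
  · simp [h, permRank_lt_of_time_lt h]
  · simp [permRank, h]
  · have := permRank_lt_of_time_lt (π := π) h
    constructor
    · intro h'; exact absurd this h'.not_gt
    · rintro (h' | h') <;> omega

lemma IsAdmissible.permRank_injective (h : IsAdmissible π) :
    Function.Injective (permRank π) := by
  intro u v huv
  have htime : u.2 = v.2 := by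
    rcases lt_trichotomy u.2 v.2 with h' | h' | h'
    · exact absurd huv (permRank_lt_of_time_lt h').ne
    · exact h'
    · exact absurd huv (permRank_lt_of_time_lt h').ne'
  have hidx : π.idxOf ((u.1, 0) : WNode m τ) = π.idxOf ((v.1, 0) : WNode m τ) := by
    simpa [permRank, htime] using huv
  have hpair := (List.idxOf_inj (h.contemp_mem u.1)).1 hidx
  exact Prod.ext (by simpa using hpair) htime

lemma permParents_subset (i : Fin m) :
    permParents loc Rg Rs π i ⊆ prefixOf π (i, 0) :=
  gstParents_subset _ _ _ _ _

lemma parents_project (v : Node m) :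
    parents (project loc Rg Rs π) v =
      place v.2 '' (permParents loc Rg Rs π v.1 : Set (WNode m τ)) := by
  ext u
  constructor
  · rintro ⟨ℓ, h1, h2⟩
    exact ⟨(u.1, ℓ), h2, Prod.ext rfl h1.symm⟩
  · rintro ⟨w, hw, rfl⟩
    exact ⟨w.2, rfl, hw⟩

lemma permRank_place_lt {w : WNode m τ} {v : Node m} (hw : w ∈ prefixOf π (v.1, 0)) :
    permRank π (place v.2 w) < permRank π v := by
  rw [permRank_lt_iff]
  obtain ⟨j, ℓ⟩ := w
  by_cases h : ℓ = 0
  · subst h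
    exact .inr ⟨by simp [place], mem_prefixOf_iff.1 hw⟩
  · have : 0 < (ℓ : ℕ) := Nat.pos_of_ne_zero fun h' => h (Fin.ext h')
    exact .inl (by simp only [place]; omega)

lemma permRank_lt_of_project {u v : Node m} (h : project loc Rg Rs π u v) :
    permRank π u < permRank π v := by
  have h' : u ∈ parents (project loc Rg Rs π) v := h
  rw [parents_project] at h'
  obtain ⟨w, hw, rfl⟩ := h'
  exact permRank_place_lt (permParents_subset v.1 hw)

lemma isTsDAG_project : IsTsDAG (project loc Rg Rs π) where
  time_order := by
    rintro u v ⟨ℓ, h, -⟩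
    omega
  acyclic v h := by
    have : ∀ u w, Relation.TransGen (project loc Rg Rs π) u w → permRank π u < permRank π w := by
      intro u w h
      induction h with
      | single h => exact permRank_lt_of_project h
      | tail _ h ih => exact ih.trans (permRank_lt_of_project h)
    exact lt_irrefl _ (this v v h)

lemma hasMaxLag_project : HasMaxLag (project loc Rg Rs π) τ := by
  rintro u v ⟨ℓ, h, -⟩
  have := ℓ.is_le
  omega

lemma repeatingEdges_project : RepeatingEdges (project loc Rg Rs π) := by
  intro i j s t r
  refine exists_congr fun ℓ => and_congr_left fun _ => ?_
  simp only
  omega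

variable {G : TsGraph m} {Ω : Type*} {E : Fin m → Type*} [∀ i, MeasurableSpace (E i)]
  [MeasurableSpace Ω] [StandardBorelSpace Ω] {μ : Measure Ω} [IsFiniteMeasure μ]
  {X : (v : Node m) → Ω → E v.1} {hX : ∀ v, Measurable (X v)} {t : ℤ}

/-- The predecessors of `(i, s)` are the prefix of `π` placed at time `s` together with the whole
past. A finite set of past variables may reach beyond the window; this is what `F` in `ci_prefix`
absorbs. -/
lemma localMarkov_project (hG : IsFaithfulModel μ hX G τ) (hloc : ScoreReflectsCI μ hX t loc)
    (hπ : IsAdmissible π) : LocalMarkov μ hX (project loc Rg Rs π) := by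
  classical
  refine localMarkov_of_ordered hπ.permRank_injective (fun _ _ => permRank_lt_of_project)
    (fun v => ?_) fun v Q hQ => ?_
  · rw [parents_project]
    exact (Finset.finite_toSet _).image _
  · rw [parents_project]
    obtain ⟨i, s⟩ := v
    have hci := hG.ci_prefix (hπ.isPrefix i) (permParents_subset i)
      (gstParents_markovBoundary hG hloc Rg Rs (hπ.isPrefix i)).1 s (Q.filter fun u => u.2 < s)
      (by simp)
    have he : place s ((i, 0) : WNode m τ) = (i, s) := Prod.ext rfl (by simp [place])
    rw [he] at hci
    refine hci.mono_right fun u hu => ?_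
    rcases permRank_lt_iff.1 (hQ u hu) with h | h
    · exact .inr (by simpa using ⟨hu, h⟩)
    · exact .inl ⟨(u.1, 0), mem_prefixOf_iff.2 h.2, Prod.ext rfl (by simpa [place] using h.1.symm)⟩

lemma subgraphMinimal_project (hG : IsFaithfulModel μ hX G τ)
    (hloc : ScoreReflectsCI μ hX t loc) (hπ : IsAdmissible π) :
    SubgraphMinimal μ hX (project loc Rg Rs π) := by
  classical
  refine ⟨localMarkov_project hG hloc hπ, fun H hH hne hM => ?_⟩
  obtain ⟨u, v, huv, hnot⟩ : ∃ u v, project loc Rg Rs π u v ∧ ¬ H u v := by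
    by_contra! hcon
    exact hne (funext fun u => funext fun v => propext ⟨hH u v, hcon u v⟩)
  obtain ⟨i, s⟩ := v
  have huv' : u ∈ parents (project loc Rg Rs π) (i, s) := huv
  rw [parents_project] at huv'
  obtain ⟨a, ha, rfl⟩ := huv'
  set S := permParents loc Rg Rs π i with hS
  have hSP : S ⊆ prefixOf π (i, 0) := permParents_subset i
  obtain ⟨hb1, hb2⟩ := gstParents_markovBoundary hG hloc Rg Rs (hπ.isPrefix i)
  have hCI : CI μ hX {((i, s) : Node m)} (S.image (place s) : Finset (Node m))
      (parents H (i, s)) := by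
    refine hM _ _ fun w hw hd => ?_
    obtain ⟨b, hb, rfl⟩ := Finset.mem_image.1 hw
    exact absurd (rank_le_of_isDescendant (fun x y h => permRank_lt_of_project (hH x y h)) hd)
      (permRank_place_lt (v := (i, s)) (hSP hb)).not_ge
  have hpa : parents H (i, s) ⊆ place s '' ((S.erase a : Finset (WNode m τ)) : Set (WNode m τ)) := by
    intro w hw
    have hw' : w ∈ parents (project loc Rg Rs π) (i, s) := hH _ _ hw
    rw [parents_project] at hw'
    obtain ⟨b, hb, rfl⟩ := hw'
    refine ⟨b, Finset.mem_coe.2 (Finset.mem_erase.2 ⟨?_, hb⟩), rfl⟩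
    rintro rfl
    exact hnot hw
  have hdel : WindowCI μ hX s (i, 0) a (S.erase a) := by
    unfold WindowCI
    have he : place s ((i, 0) : WNode m τ) = (i, s) := Prod.ext rfl (by simp [place])
    rw [he]
    refine hCI.enlarge_cond ?_ hpa ?_
    · rintro _ rfl
      exact Finset.mem_coe.2 (Finset.mem_image_of_mem _ ha)
    · rintro _ ⟨b, hb, rfl⟩
      exact .inl (Finset.mem_coe.2 (Finset.mem_image_of_mem _ (Finset.mem_of_mem_erase hb)))
  have hall := hG.windowCI_erase (hπ.isPrefix i) hSP hb1 ha hdel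
  -- The missing edge made `a` redundant at time `s`; the shrink phase excludes this at time `t`, so
  -- the independence is carried there.
  have hci := hG.ci_prefix (hπ.isPrefix i) ((Finset.erase_subset _ _).trans hSP) hall t ∅ (by simp)
  exact hb2 a ha (hci.mono_right
    (Set.singleton_subset_iff.2 (.inl (Set.mem_image_of_mem _ (hSP ha)))))

end Project

/-! ## Consequences of local consistency -/

section Consistency

variable {m τ : ℕ}

/-- The DAG in which `v` has the parents `S` and all other variables have no parents. -/
def WDAG.ofFamily (v : WNode m τ) (S : Finset (WNode m τ)) (hv : v ∉ S) : WDAG m τ where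
  pa := Function.update (fun _ => ∅) v S
  acyclic := by
    have hedge : ∀ x y, x ∈ Function.update (fun _ => (∅ : Finset (WNode m τ))) v S y →
        y = v ∧ x ∈ S := by
      intro x y h
      by_cases hy : y = v
      · subst hy; exact ⟨rfl, by simpa using h⟩
      · simp [hy] at h
    intro u hu
    obtain ⟨x, hx, -⟩ := Relation.TransGen.head'_iff.1 hu
    obtain ⟨y, -, hy⟩ := Relation.TransGen.tail'_iff.1 hu
    exact hv ((hedge y u hy).1 ▸ (hedge u x hx).2)

/-- The two DAGs differ only in the parents of `v`, so the other local scores cancel. Local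
consistency thereby becomes a statement about single local scores. -/
lemma WDAG.score_ofFamily_lt_iff (loc : LocalScore m τ) (v : WNode m τ)
    {S T : Finset (WNode m τ)} (hS : v ∉ S) (hT : v ∉ T) :
    (WDAG.ofFamily v S hS).score loc < (WDAG.ofFamily v T hT).score loc ↔ loc v S < loc v T := by
  simp only [WDAG.score, WDAG.ofFamily]
  rw [← Finset.add_sum_erase _ _ (Finset.mem_univ v), ← Finset.add_sum_erase _ _
    (Finset.mem_univ v)]
  have hrest : ∀ U : Finset (WNode m τ), ∑ x ∈ Finset.univ.erase v,
      loc x (Function.update (fun _ => (∅ : Finset (WNode m τ))) v U x) = ∑ x ∈ Finset.univ.erase v, loc x ∅ := by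
    intro U
    refine Finset.sum_congr rfl fun x hx => ?_
    rw [Function.update_of_ne (Finset.ne_of_mem_erase hx)]
  rw [hrest, hrest, Function.update_self, Function.update_self, add_lt_add_iff_right]

variable {Ω Ω' : Type*} {E : Fin m → Type*} [∀ i, MeasurableSpace (E i)]
  [MeasurableSpace Ω] [StandardBorelSpace Ω] {μ : Measure Ω} [IsFiniteMeasure μ]
  {X : (v : Node m) → Ω → E v.1} {hX : ∀ v, Measurable (X v)} {t : ℤ}
  [MeasurableSpace Ω'] {P : Measure Ω'} {D : ℕ → Ω' → Sample E τ}
  {B : (n : ℕ) → (Fin n → Sample E τ) → LocalScore m τ}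

lemma LocallyConsistent.tendsto_scoreReflectsCI (hcons : LocallyConsistent μ hX t P D B) :
    Tendsto (fun n => P {ω | ¬ ScoreReflectsCI μ hX t (B n fun k => D k ω)}) atTop (𝓝 0) := by
  classical
  -- The event that the comparison for the triple `c = (v, a, S)` goes wrong; it is empty for
  -- triples violating the side conditions.
  let bad : WNode m τ × WNode m τ × Finset (WNode m τ) → ℕ → Set Ω' := fun c n =>
    {ω | ¬ (c.2.1 ∉ c.2.2 → c.1 ∉ insert c.2.1 c.2.2 →
      (¬ WindowCI μ hX t c.1 c.2.1 c.2.2 →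
        B n (fun k => D k ω) c.1 c.2.2 < B n (fun k => D k ω) c.1 (insert c.2.1 c.2.2)) ∧
      (WindowCI μ hX t c.1 c.2.1 c.2.2 →
        B n (fun k => D k ω) c.1 (insert c.2.1 c.2.2) < B n (fun k => D k ω) c.1 c.2.2))}
  have hbad : ∀ c, Tendsto (fun n => P (bad c n)) atTop (𝓝 0) := by
    rintro ⟨v, a, S⟩
    by_cases h1 : a ∈ S
    · simp [bad, h1]
    by_cases h2 : v ∈ insert a S
    · simp only [bad, h2]; simp
    have h3 : v ∉ S := fun h => h2 (Finset.mem_insert_of_mem h)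
    obtain ⟨hdep, hind⟩ := hcons (WDAG.ofFamily v S h3) (WDAG.ofFamily v (insert a S) h2) a v
      (by simpa [WDAG.ofFamily] using h1) (by simp [WDAG.ofFamily])
    simp only [WDAG.score_ofFamily_lt_iff] at hdep hind
    have hpa : (WDAG.ofFamily v S h3).pa v = S := by simp [WDAG.ofFamily]
    rw [hpa] at hdep hind
    by_cases hCI : WindowCI μ hX t v a S
    · simpa only [bad, h1, h2, hCI, not_false_eq_true, forall_const, not_true_eq_false,
        false_imp_iff, true_and] using hind hCI
    · simpa only [bad, h1, h2, hCI, not_false_eq_true, forall_const, false_imp_iff,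
        and_true] using hdep hCI
  have hsum : Tendsto (fun n => ∑ c, P (bad c n)) atTop (𝓝 0) := by
    simpa using tendsto_finsetSum Finset.univ fun c _ => hbad c
  refine tendsto_of_tendsto_of_tendsto_of_le_of_le tendsto_const_nhds hsum
    (fun _ => zero_le) fun n => ?_
  refine (measure_mono fun ω hω => ?_).trans (measure_iUnion_fintype_le P fun c => bad c n)
  by_contra hcon
  simp only [Set.mem_iUnion, not_exists] at hcon
  refine hω fun v a S h1 h2 => ?_
  have := hcon (v, a, S)
  simp only [bad, Set.mem_ofPred_eq, not_not] at this
  exact this h1 h2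

end Consistency

theorem lemma6 {m τ : ℕ}
    -- the time series and the ts-SCM that generates it
    {Ω : Type*} [MeasurableSpace Ω] [StandardBorelSpace Ω] (μ : Measure Ω) [IsProbabilityMeasure μ]
    {E : Fin m → Type*} [∀ i, MeasurableSpace (E i)]
    {N : Fin m → Type*} [∀ j, MeasurableSpace (N j)]
    (X : (v : Node m) → Ω → E v.1) (hX : ∀ v, Measurable (X v))
    (η : (j : Fin m) → ℤ → Ω → N j)
    (f : (j : Fin m) → ℤ → ((i : Fin m) → ℕ → E i) → N j → E j)
    (G : TsGraph m) (hscm : IsTsSCM μ X η f G)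
    -- the assumptions on the time series
    (hmarkov : LocalMarkov μ hX G) (hfaith : Faithful μ hX G)
    (hlag : HasMaxLag G τ) (hstat : StationaryMechanisms f G)
    -- i.i.d. data for the variables of the window that ends at time `t`
    (t : ℤ) {Ω' : Type*} [MeasurableSpace Ω'] (P : Measure Ω') [IsProbabilityMeasure P]
    (D : ℕ → Ω' → Sample E τ) (hD : ∀ k, Measurable (D k)) (hindep : iIndepFun D P)
    (hlaw : ∀ k, P.map (D k) = μ.map fun ω w => X (place t w) ω)
    -- a decomposable scoring criterion that is locally consistent
    (B : (n : ℕ) → (Fin n → Sample E τ) → LocalScore m τ)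
    (hcons : LocallyConsistent μ hX t P D B)
    -- the tie breaking in the grow phase and the order of deletions in the shrink phase
    (Rg Rs : (n : ℕ) → (Fin n → Sample E τ) → SelectionRule (WNode m τ)) :
    (∀ (n : ℕ) (d : Fin n → Sample E τ),
      IsTsDAG (tsBossPhase1 (B n d) (Rg n d) (Rs n d)) ∧
      HasMaxLag (tsBossPhase1 (B n d) (Rg n d) (Rs n d)) τ ∧
      RepeatingEdges (tsBossPhase1 (B n d) (Rg n d) (Rs n d))) ∧
    Tendsto (fun n => P {ω | ¬ (
        LocalMarkov μ hX (tsBossPhase1 (B n fun k => D k ω) (Rg n fun k => D k ω)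
          (Rs n fun k => D k ω)) ∧
        SubgraphMinimal μ hX (tsBossPhase1 (B n fun k => D k ω) (Rg n fun k => D k ω)
          (Rs n fun k => D k ω)))})
      atTop (𝓝 0) := by
  have hG : IsFaithfulModel μ hX G τ := ⟨hscm.dag, hmarkov, hfaith, hlag, hstat.repeating⟩
  refine ⟨fun n d => ⟨isTsDAG_project, hasMaxLag_project, repeatingEdges_project⟩, ?_⟩
  refine tendsto_of_tendsto_of_tendsto_of_le_of_le tendsto_const_nhds
    hcons.tendsto_scoreReflectsCI (fun _ => zero_le) fun n => ?_
  refine measure_mono fun ω hω hloc => hω ?_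
  have hπ := isAdmissible_initPerm.permSearch (B n fun k => D k ω) (Rg n fun k => D k ω)
    (Rs n fun k => D k ω)
  exact ⟨localMarkov_project hG hloc hπ, subgraphMinimal_project hG hloc hπ⟩
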